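/- **Setting.** For real $m\ge \tfrac12$ let $U_{L^2_m}$ be the completion of $\{f\in C^\infty(\mathbb R/2\pi\mathbb Z,\mathbb R): \int f\,d\theta=0\}$ in the norm $\|f\|_{L^2_m}^2=\frac1\pi\int_0^{2\pi}\bigl|\,|\tfrac{d}{d\theta}|^m f(\theta)\bigr|^2d\theta$, where $|\tfrac{d}{d\theta}|^m$ is the Fourier multiplier $|n|^m$. Let $T$ be the circle group, $\Pi_T=\ker(\exp:\mathbb R\to T)\cong\mathbb Z$ (discrete), and let $LT_{L^2_m}=T\times\Pi_T\times U_{L^2_m}$ be the topological group of $L^2_m$-loops in $T$. For $m'>m$ there is a canonical continuous inclusion $i_{m',m}:LT_{L^2_{m'}}\to LT_{L^2_m}$, through which $LT_{L^2_{m'}}$ acts on everything on which $LT_{L^2_m}$ acts. All $C^*$-algebras are complex. For a topological group $G$, a $G$-algebra is a $\mathbb Z_2$-graded $C^*$-algebra $A$ (the grading is given by a $*$-automorphism of order at most $2$) with an action of $G$ by grading-preserving $*$-automorphisms such that $g\mapsto g(a)$ is norm-continuous for every $a\in A$. If $J$ is a $G$-algebra, the grading and the action extend to the multiplier algebra $\mathcal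 M(J)$, which contains $J$ as an ideal; a ($C^*$-)subalgebra of $\mathcal M(J)$ is said to be a $G$-algebra if it is so for the restricted grading and action, and $x\in\mathcal M(J)$ is called $G$-continuous if $g\mapsto g(x)$ is norm-continuous. $[\cdot,\cdot]$ denotes the graded commutator, i.e. the bilinear extension of $[x,y]=xy-(-1)^{\partial x\,\partial y}yx$, and a set $\Delta\subseteq\mathcal M(J)$ *derives* a subalgebra $A$ if $[d,a]\in A$ for all $d\in\Delta$, $a\in A$. A $C^*$-algebra is $\sigma$-unital if it has a countable approximate unit. **Theorem.** Let $m'>m\ge\frac12$. Let $J$ be a $\sigma$-unital $LT_{L^2_m}$-algebra and let $A_1$, $A_2$ be $\sigma$-unital $C^*$-subalgebras of $\mathcal M(J)$ such that $A_1$ is an $LT_{L^2_m}$-algebra. Let $\Delta\subseteq\mathcal M(J)$ be a norm-separable subset that derives $A_1$, and let $\varphi:LT_{L^2_m}\to\mathcal M(J)$ be a bounded function. Assume that $$A_1\cdot A_2\subseteq J,\qquad A_1\cdot\varphi(LT_{L^2_m})\subseteq J,\qquad \varphi(LT_{L^2_m})\cdot A_1\subseteq J,$$ and that for every $a\in A_1+J$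 the functions $g\mapsto a\varphi(g)$ and $g\mapsto\varphi(g)a$ are norm-continuous on $LT_{L^2_m}$. Then there are $LT_{L^2_{m'}}$-continuous positive even elements $M_1,M_2\in\mathcal M(J)$ with $M_1+M_2=1$ such that, for $i=1,2$, all elements $$M_ia_i,\quad [M_i,d],\quad M_2\varphi(g),\quad \varphi(g)M_2,\quad g(M_i)-M_i$$ belong to $J$ for all $a_i\in A_i$, $d\in\Delta$, $g\in LT_{L^2_{m'}}$ (where $\varphi(g)$ means $\varphi(i_{m',m}(g))$ and $g(M_i)$ means $i_{m',m}(g)(M_i)$), and such that the functions $g\mapsto M_2\varphi(g)$ and $g\mapsto\varphi(g)M_2$ are norm-continuous on $LT_{L^2_{m'}}$. -/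

import Mathlib

open scoped ContDiff MultiplierAlgebra CStarAlgebra

noncomputable section

namespace LoopKK

/-! ### The Hilbert Lie groups of Sobolev loops in the circle group -/

instance factTwoPiPos : Fact (0 < 2 * Real.pi) := ⟨Real.two_pi_pos⟩

/-- The real vector space of smooth functions `f : 𝕋 → ℝ` on the rotation circle `ℝ / 2πℤ`
(written as `2π`-periodic functions on `ℝ`) with `∫ f = 0`. -/
def smoothMeanZero : Submodule ℝ (ℝ → ℝ) where
  carrier := {f | ContDiff ℝ ∞ f ∧ Function.Periodic f (2 * Real.pi) ∧
    ∫ θ in (0 : ℝ)..(2 * Real.pi), f θ = 0}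
  zero_mem' := ⟨contDiff_const, fun _ => rfl, by simp⟩
  add_mem' := by
    rintro f g ⟨hf, hfp, hfi⟩ ⟨hg, hgp, hgi⟩
    refine ⟨hf.add hg, hfp.add hgp, ?_⟩
    simp only [Pi.add_apply]
    rw [intervalIntegral.integral_add (hf.continuous.intervalIntegrable _ _)
      (hg.continuous.intervalIntegrable _ _), hfi, hgi, add_zero]
  smul_mem' := by
    rintro c f ⟨hf, hfp, hfi⟩
    refine ⟨contDiff_const.smul hf, fun x => ?_, ?_⟩
    · simp [hfp x]
    · simp [hfi]

/-- The Fourier coefficient `(1/2π) ∫₀^{2π} e^{-inθ} f(θ) dθ` of a real function. -/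
def fourierC (f : ℝ → ℝ) (n : ℤ) : ℂ :=
  fourierCoeffOn Real.two_pi_pos (fun θ => (f θ : ℂ)) n

theorem fourierC_eq (f : ℝ → ℝ) (n : ℤ) :
    fourierC f n = 1 / (2 * Real.pi) * ∫ θ in (0 : ℝ)..(2 * Real.pi),
      Complex.exp (-(n * θ * Complex.I)) * f θ := by
  rw [fourierC, fourierCoeffOn_eq_integral, Complex.real_smul]
  congr 1
  · simp
  · refine intervalIntegral.integral_congr fun θ _ => ?_
    have hpi : (Real.pi : ℂ) ≠ 0 := by exact_mod_cast Real.pi_ne_zero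
    simp only [fourier_coe_apply, smul_eq_mul]
    congr 2
    push_cast
    field_simp
    ring

theorem fourierC_add {f g : ℝ → ℝ} (hf : Continuous f) (hg : Continuous g) (n : ℤ) :
    fourierC (f + g) n = fourierC f n + fourierC g n := by
  simp only [fourierC_eq, Pi.add_apply, Complex.ofReal_add, mul_add]
  rw [intervalIntegral.integral_add, mul_add]
  all_goals
    apply Continuous.intervalIntegrable
    fun_prop

theorem fourierC_smul (c : ℝ) (f : ℝ → ℝ) (n : ℤ) :
    fourierC (c • f) n = c * fourierC f n := by
  simp only [fourierC_eq, Pi.smul_apply, smul_eq_mul, Complex.ofReal_mul]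
  rw [mul_left_comm (c : ℂ), ← intervalIntegral.integral_const_mul (c : ℂ)]
  congr 2
  funext θ
  ring

theorem norm_fourierC_deriv {f : ℝ → ℝ} (hf : ContDiff ℝ ∞ f)
    (hp : Function.Periodic f (2 * Real.pi)) (n : ℤ) :
    |(n : ℝ)| * ‖fourierC f n‖ ≤ ‖fourierC (deriv f) n‖ := by
  rcases eq_or_ne n 0 with rfl | hn
  · simp
  have hd : Continuous (deriv f) := hf.continuous_deriv (by simp)
  have h := fourierCoeffOn_of_hasDerivAt (f := fun θ => (f θ : ℂ))
    (f' := fun θ => ((deriv f θ : ℝ) : ℂ)) Real.two_pi_pos hn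
    (fun x _ => ((hf.differentiable (by simp)) x).hasDerivAt.ofReal_comp)
    ((Complex.continuous_ofReal.comp hd).intervalIntegrable _ _)
  have h0 : f (2 * Real.pi) = f 0 := by simpa using hp 0
  have hpi : (Real.pi : ℝ) ≠ 0 := Real.pi_ne_zero
  have hn' : |(n : ℝ)| ≠ 0 := by simpa using hn
  rw [h0, sub_self, mul_zero, zero_sub] at h
  change |(n : ℝ)| * ‖fourierCoeffOn Real.two_pi_pos (fun θ => (f θ : ℂ)) n‖ ≤
    ‖fourierCoeffOn Real.two_pi_pos (fun θ => ((deriv f θ : ℝ) : ℂ)) n‖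
  rw [h]
  apply le_of_eq
  simp only [Complex.ofReal_mul, Complex.ofReal_ofNat, Complex.ofReal_zero, sub_zero, norm_mul,
    norm_div, norm_neg, norm_one, Complex.norm_ofNat, Complex.norm_real, Complex.norm_I,
    Complex.norm_intCast, Real.norm_eq_abs, abs_of_pos Real.pi_pos]
  field_simp

theorem summable_sq_fourierC {f : ℝ → ℝ} (hf : Continuous f) :
    Summable fun n : ℤ => ‖fourierC f n‖ ^ 2 := by
  refine (hasSum_sq_fourierCoeffOn Real.two_pi_pos (f := fun θ => (f θ : ℂ)) ?_).summable
  have hc : Continuous fun θ => (f θ : ℂ) := Complex.continuous_ofReal.comp hf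
  obtain ⟨C, hC⟩ := (isCompact_Icc (a := (0 : ℝ)) (b := 2 * Real.pi)).exists_bound_of_continuousOn
    hc.continuousOn
  refine MeasureTheory.MemLp.of_bound hc.aestronglyMeasurable C ?_
  filter_upwards [MeasureTheory.ae_restrict_mem measurableSet_Ioc] with x hx
  exact hC x (Set.Ioc_subset_Icc_self hx)

theorem summable_sq_pow_fourierC (k : ℕ) : ∀ f : ℝ → ℝ, ContDiff ℝ ∞ f →
    Function.Periodic f (2 * Real.pi) →
    Summable fun n : ℤ => (|(n : ℝ)| ^ k * ‖fourierC f n‖) ^ 2 := by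
  induction k with
  | zero => intro f hf _; simpa using summable_sq_fourierC hf.continuous
  | succ k ih =>
    intro f hf hp
    have hd : ContDiff ℝ ∞ (deriv f) := (contDiff_infty_iff_deriv.1 hf).2
    have hdp : Function.Periodic (deriv f) (2 * Real.pi) := fun x => by
      rw [← deriv_comp_add_const]
      congr 1
      exact funext hp
    refine (ih _ hd hdp).of_nonneg_of_le (fun n => by positivity) fun n => ?_
    rw [pow_succ |(n : ℝ)| k, mul_assoc]
    gcongr
    exact norm_fourierC_deriv hf hp n

theorem fourierC_zero_of_mem {f : ℝ → ℝ} (hf : f ∈ smoothMeanZero) : fourierC f 0 = 0 := by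
  rw [fourierC_eq]
  have : ∫ θ in (0 : ℝ)..(2 * Real.pi), (f θ : ℂ) = 0 := by
    rw [intervalIntegral.integral_ofReal, hf.2.2, Complex.ofReal_zero]
  simp [this]

theorem memlp_weighted (m : ℝ) (f : smoothMeanZero) :
    Memℓp (fun n : ℤ => ((|(n : ℝ)| ^ m : ℝ) : ℂ) * fourierC f n) 2 := by
  rw [memℓp_gen_iff (by simp)]
  obtain ⟨k, hk⟩ := exists_nat_ge m
  refine (summable_sq_pow_fourierC k f f.2.1 f.2.2.1).of_nonneg_of_le
    (fun n => by positivity) fun n => ?_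
  simp only [ENNReal.toReal_ofNat, Real.rpow_ofNat, norm_mul, Complex.norm_real]
  rcases eq_or_ne n 0 with rfl | hn
  · simp [fourierC_zero_of_mem f.2]
  · have h1 : (1 : ℝ) ≤ |(n : ℝ)| := by exact_mod_cast Int.one_le_abs hn
    gcongr
    rw [Real.norm_of_nonneg (by positivity), ← Real.rpow_natCast]
    exact Real.rpow_le_rpow_of_exponent_le h1 hk

/-- The function `|d/dθ|^m f ∈ L²(𝕋)`: the operator `|d/dθ|^m` is diagonal in the Fourier basis,
with eigenvalue `|n|^m` on `e^{inθ}`. -/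
def absDerivPow (m : ℝ) : smoothMeanZero →ₗ[ℝ]
    MeasureTheory.Lp ℂ 2 (AddCircle.haarAddCircle (T := 2 * Real.pi)) where
  toFun f := fourierBasis.repr.symm ⟨_, memlp_weighted m f⟩
  map_add' f g := by
    rw [← map_add]
    congr 1
    ext n
    change ((|(n : ℝ)| ^ m : ℝ) : ℂ) * fourierC (f + g : ℝ → ℝ) n =
      ((|(n : ℝ)| ^ m : ℝ) : ℂ) * fourierC f n + ((|(n : ℝ)| ^ m : ℝ) : ℂ) * fourierC g n
    rw [fourierC_add f.2.1.continuous g.2.1.continuous, mul_add]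
  map_smul' c f := by
    have : (c • fourierBasis.repr.symm ⟨_, memlp_weighted m f⟩ :
        MeasureTheory.Lp ℂ 2 (AddCircle.haarAddCircle (T := 2 * Real.pi))) =
        (c : ℂ) • fourierBasis.repr.symm ⟨_, memlp_weighted m f⟩ := rfl
    rw [RingHom.id_apply, this, ← map_smul]
    congr 1
    ext n
    change ((|(n : ℝ)| ^ m : ℝ) : ℂ) * fourierC (c • (f : ℝ → ℝ)) n =
      (c : ℂ) * (((|(n : ℝ)| ^ m : ℝ) : ℂ) * fourierC f n)
    rw [fourierC_smul]
    ring

/-- `(1/π) ∫₀^{2π} |g(θ)|² dθ` is twice the square of the `L²`-norm of `g` with respect to the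
normalized Haar measure, whence the factor `√2`. -/
def sobolevMap (m : ℝ) : smoothMeanZero →ₗ[ℝ]
    MeasureTheory.Lp ℂ 2 (AddCircle.haarAddCircle (T := 2 * Real.pi)) :=
  Real.sqrt 2 • absDerivPow m

theorem norm_sobolevMap_sq (m : ℝ) (f : smoothMeanZero) :
    ‖sobolevMap m f‖ ^ 2 = 2 * ∑' n : ℤ, (|(n : ℝ)| ^ m * ‖fourierC f n‖) ^ 2 := by
  have h := lp.norm_rpow_eq_tsum (p := 2) (by simp)
    (⟨_, memlp_weighted m f⟩ : lp (fun _ : ℤ => ℂ) 2)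
  simp only [ENNReal.toReal_ofNat, Real.rpow_ofNat, norm_mul, Complex.norm_real] at h
  rw [sobolevMap, LinearMap.smul_apply, norm_smul, mul_pow, Real.norm_of_nonneg (by positivity),
    Real.sq_sqrt (by norm_num), absDerivPow, LinearMap.coe_mk, AddHom.coe_mk,
    LinearIsometryEquiv.norm_map, h]
  congr 1
  refine tsum_congr fun n => ?_
  rw [Real.norm_of_nonneg (by positivity)]

theorem sobolevMap_injective (m : ℝ) : Function.Injective (sobolevMap m) := by
  rw [injective_iff_map_eq_zero]
  intro f hf
  have h0 : absDerivPow m f = 0 := by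
    have : Real.sqrt 2 ≠ 0 := by positivity
    simpa [sobolevMap, this] using hf
  have h1 : (⟨_, memlp_weighted m f⟩ : lp (fun _ : ℤ => ℂ) 2) = 0 := by
    simpa [absDerivPow] using h0
  have h2 : ∀ n : ℤ, fourierC f n = 0 := by
    intro n
    rcases eq_or_ne n 0 with rfl | hn
    · exact fourierC_zero_of_mem f.2
    have := congrFun (congrArg Subtype.val h1) n
    have hn' : (|(n : ℝ)| ^ m : ℝ) ≠ 0 := by
      have : 0 < |(n : ℝ)| := by simpa using hn
      positivity
    simpa [hn'] using this
  have hc : Continuous fun θ => ((f : ℝ → ℝ) θ : ℂ) :=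
    Complex.continuous_ofReal.comp f.2.1.continuous
  have hL2 : MeasureTheory.MemLp (fun θ => ((f : ℝ → ℝ) θ : ℂ)) 2
      (MeasureTheory.volume.restrict (Set.Ioc 0 (2 * Real.pi))) := by
    obtain ⟨C, hC⟩ := (isCompact_Icc (a := (0 : ℝ))
      (b := 2 * Real.pi)).exists_bound_of_continuousOn hc.continuousOn
    refine MeasureTheory.MemLp.of_bound hc.aestronglyMeasurable C ?_
    filter_upwards [MeasureTheory.ae_restrict_mem measurableSet_Ioc] with x hx
    exact hC x (Set.Ioc_subset_Icc_self hx)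
  have h3 := tsum_sq_fourierCoeffOn Real.two_pi_pos hL2
  have h4 : ∫ θ in (0 : ℝ)..(2 * Real.pi), ‖((f : ℝ → ℝ) θ : ℂ)‖ ^ 2 = 0 := by
    have h5 : ∀ n : ℤ, fourierCoeffOn Real.two_pi_pos
      (fun θ => ((f : ℝ → ℝ) θ : ℂ)) n = 0 := h2
    simp only [h5] at h3
    have hpi := Real.pi_ne_zero
    simpa [hpi] using h3.symm
  have h6 : ∀ x ∈ Set.Icc (0 : ℝ) (2 * Real.pi), (f : ℝ → ℝ) x = 0 := by
    intro x hx
    by_contra hne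
    have := intervalIntegral.integral_pos Real.two_pi_pos
      (f := fun θ => ‖((f : ℝ → ℝ) θ : ℂ)‖ ^ 2) (hc.norm.pow 2).continuousOn
      (fun _ _ => by positivity) ⟨x, hx, by
        have : ((f : ℝ → ℝ) x : ℂ) ≠ 0 := by exact_mod_cast hne
        positivity⟩
    exact this.ne' h4
  ext x
  obtain ⟨y, hy, hxy⟩ := f.2.2.1.exists_mem_Ico₀ Real.two_pi_pos x
  rw [hxy]
  exact h6 y ⟨hy.1, hy.2.le⟩

/-- Smooth mean-zero functions, equipped with the `L²_m`-norm
`‖f‖² = (1/π) ∫₀^{2π} | |d/dθ|^m f(θ) |² dθ`. -/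
def PreU (_m : ℝ) : Type := smoothMeanZero

instance (m : ℝ) : AddCommGroup (PreU m) := inferInstanceAs (AddCommGroup smoothMeanZero)

instance (m : ℝ) : Module ℝ (PreU m) := inferInstanceAs (Module ℝ smoothMeanZero)

instance (m : ℝ) : NormedAddCommGroup (PreU m) :=
  NormedAddCommGroup.induced (PreU m)
    (MeasureTheory.Lp ℂ 2 (AddCircle.haarAddCircle (T := 2 * Real.pi)))
    (sobolevMap m) (sobolevMap_injective m)

instance (m : ℝ) : NormedSpace ℝ (PreU m) :=
  NormedSpace.induced ℝ (PreU m)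
    (MeasureTheory.Lp ℂ 2 (AddCircle.haarAddCircle (T := 2 * Real.pi))) (sobolevMap m)

/-- `U_{L²_m}`: the completion of the smooth mean-zero functions in the `L²_m`-norm. -/
abbrev U (m : ℝ) : Type := UniformSpace.Completion (PreU m)

theorem norm_preU_mono {m m' : ℝ} (h : m ≤ m') (f : smoothMeanZero) :
    ‖sobolevMap m f‖ ≤ ‖sobolevMap m' f‖ := by
  rw [← sq_le_sq₀ (norm_nonneg _) (norm_nonneg _), norm_sobolevMap_sq, norm_sobolevMap_sq]
  have hs : ∀ s : ℝ, Summable fun n : ℤ => (|(n : ℝ)| ^ s * ‖fourierC f n‖) ^ 2 := by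
    intro s
    have := (memℓp_gen_iff (by simp)).1 (memlp_weighted s f)
    refine this.congr fun n => ?_
    simp only [ENNReal.toReal_ofNat, Real.rpow_ofNat, norm_mul, Complex.norm_real]
    rw [Real.norm_of_nonneg (by positivity)]
  refine mul_le_mul_of_nonneg_left ((hs m).tsum_le_tsum (fun n => ?_) (hs m')) (by norm_num)
  rcases eq_or_ne n 0 with rfl | hn
  · simp [fourierC_zero_of_mem f.2]
  · have h1 : (1 : ℝ) ≤ |(n : ℝ)| := by exact_mod_cast Int.one_le_abs hn
    gcongr

/-- The identity of smooth mean-zero functions, as a bounded map from the `L²_{m'}`-norm to the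
`L²_m`-norm. -/
def preUIncl {m m' : ℝ} (h : m ≤ m') : NormedAddGroupHom (PreU m') (PreU m) :=
  AddMonoidHom.mkNormedAddGroupHom
    ({ toFun := fun f => (show smoothMeanZero from f)
       map_zero' := rfl
       map_add' := fun _ _ => rfl } : PreU m' →+ PreU m) 1
    (fun f => by rw [one_mul]; exact norm_preU_mono h f)

/-- The continuous homomorphism `U_{L²_{m'}} → U_{L²_m}`. -/
def uIncl {m m' : ℝ} (h : m ≤ m') : NormedAddGroupHom (U m') (U m) :=
  (preUIncl h).completion

/-- `Π_T`: the kernel of `exp : 𝔱 = ℝ → T`, with its (discrete) topology as a subgroup of `ℝ`. -/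
abbrev PiT : AddSubgroup ℝ := Circle.expHom.ker

/-- `LT_{L²_m} = T × Π_T × U_{L²_m}`. -/
abbrev LT (m : ℝ) : Type := Circle × Multiplicative PiT × Multiplicative (U m)

/-- The inclusion `i_{m',m} : LT_{L²_{m'}} → LT_{L²_m}` of topological groups. -/
def ltIncl {m m' : ℝ} (h : m ≤ m') : LT m' →* LT m :=
  (MonoidHom.id Circle).prodMap ((MonoidHom.id (Multiplicative PiT)).prodMap
    (AddMonoidHom.toMultiplicative (uIncl h).toAddMonoidHom))

theorem continuous_ltIncl {m m' : ℝ} (h : m ≤ m') : Continuous (ltIncl h) :=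
  continuous_id.prodMap (continuous_id.prodMap (uIncl h).continuous)

/-! ### Graded `G`-algebras and their multiplier algebras -/

/-- A `ℤ/2`-graded `G`-`C*`-algebra structure on `A`: a grading automorphism of order at most `2`
and an action of `G` by even `*`-automorphisms such that `g ↦ g(a)` is norm-continuous for
every `a`. -/
structure GAlgebra (G : Type*) [Group G] [TopologicalSpace G]
    (A : Type*) [NonUnitalCStarAlgebra A] where
  grading : A ≃⋆ₐ[ℂ] A
  grading_grading : ∀ a, grading (grading a) = a
  act : G →* (A ≃⋆ₐ[ℂ] A)
  act_grading : ∀ g a, act g (grading a) = grading (act g a)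
  continuous_act : ∀ a, Continuous fun g => act g a

/-- `a` is positive: `a = b* b` for some `b` in the algebra. -/
def IsPos {A : Type*} [Mul A] [Star A] (a : A) : Prop := ∃ b : A, a = star b * b

/-- A `C*`-algebra is `σ`-unital if it has a countable approximate unit (an increasing sequence of
positive elements of norm at most one, acting asymptotically as a unit). -/
def IsSigmaUnital (A : Type*) [NonUnitalNormedRing A] [Star A] : Prop :=
  ∃ u : ℕ → A, (∀ i, IsPos (u i)) ∧ (∀ i, ‖u i‖ ≤ 1) ∧ (∀ i, IsPos (u (i + 1) - u i)) ∧
    ∀ a, Filter.Tendsto (fun i => u i * a) Filter.atTop (nhds a) ∧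
      Filter.Tendsto (fun i => a * u i) Filter.atTop (nhds a)

section Multiplier

variable {J : Type*} [NonUnitalCStarAlgebra J]

/-- A `*`-automorphism of `J` as a continuous linear map. -/
def autCLM (α : J ≃⋆ₐ[ℂ] J) : J →L[ℂ] J where
  toFun := α
  map_add' := map_add α
  map_smul' := map_smul α
  cont := (NonUnitalStarAlgHom.isometry α (EquivLike.injective α)).continuous

/-- The extension of a `*`-automorphism `α` of `J` to the multiplier algebra,
`(L, R) ↦ (α L α⁻¹, α R α⁻¹)`. -/
def extendAut (α : J ≃⋆ₐ[ℂ] J) (x : 𝓜(ℂ, J)) : 𝓜(ℂ, J) where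
  fst := autCLM α ∘L x.fst ∘L autCLM α.symm
  snd := autCLM α ∘L x.snd ∘L autCLM α.symm
  central a b := by
    have h := congrArg α (x.central (α.symm a) (α.symm b))
    simpa [autCLM] using h

theorem extendAut_coe (α : J ≃⋆ₐ[ℂ] J) (a : J) :
    extendAut α (a : 𝓜(ℂ, J)) = (α a : J) := by
  refine DoubleCentralizer.ext _ _ _ _ (Prod.ext ?_ ?_) <;> ext b <;>
    simp [extendAut, autCLM]

/-- The multiplier `x` belongs to `J ⊆ 𝓜(J)`. -/
def MemJ (x : 𝓜(ℂ, J)) : Prop := ∃ a : J, (a : 𝓜(ℂ, J)) = x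

variable {G : Type*} [Group G] [TopologicalSpace G] (E : GAlgebra G J)

/-- The action of `g ∈ G` on `𝓜(J)`. -/
def mAct (g : G) (x : 𝓜(ℂ, J)) : 𝓜(ℂ, J) := extendAut (E.act g) x

/-- The grading automorphism of `𝓜(J)`. -/
def mGrading (x : 𝓜(ℂ, J)) : 𝓜(ℂ, J) := extendAut E.grading x

/-- The multiplier `x` is even. -/
def IsEven (x : 𝓜(ℂ, J)) : Prop := mGrading E x = x

/-- The even part of `x`. -/
def evenPart (x : 𝓜(ℂ, J)) : 𝓜(ℂ, J) := (1 / 2 : ℂ) • (x + mGrading E x)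

/-- The odd part of `x`. -/
def oddPart (x : 𝓜(ℂ, J)) : 𝓜(ℂ, J) := (1 / 2 : ℂ) • (x - mGrading E x)

/-- The graded commutator: the bilinear extension of `[x, y] = x y - (-1)^{∂x ∂y} y x`. -/
def gradedComm (x y : 𝓜(ℂ, J)) : 𝓜(ℂ, J) :=
  x * y - (evenPart E y * evenPart E x + evenPart E y * oddPart E x
    + oddPart E y * evenPart E x - oddPart E y * oddPart E x)

/-- The subalgebra `A` of `𝓜(J)` is a `G`-algebra for the grading and the action of `𝓜(J)`:
it is invariant under both, and `G` acts norm-continuously on it. -/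
def IsGSubalgebra (A : NonUnitalStarSubalgebra ℂ 𝓜(ℂ, J)) : Prop :=
  (∀ a ∈ A, mGrading E a ∈ A) ∧ (∀ g, ∀ a ∈ A, mAct E g a ∈ A) ∧
    ∀ a ∈ A, Continuous fun g => mAct E g a

end Multiplier

end LoopKK

end

namespace LoopKK

open Filter Topology

/-! ### Averages of asymptotically orthogonal sequences -/

section Averaging

variable {A : Type*} [CStarAlgebra A]

/-! This is Kasparov's technical theorem, with a compact Sobolev embedding in place of local
compactness of the group. Put M₂ = Σ X_k and M₁ = 1 - M₂, where X_k = √D_k u_k √D_k ≈ D_k u_k. Here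
u_k is an increasing even approximate unit of A₁ that asymptotically commutes with a dense sequence
in Δ, and D_k = b_{k+1} - b_k are the increments of an approximate unit of J, chosen after the u_k.
As X_k ≤ D_k, the sum converges strictly and 0 ≤ M₂ ≤ 1 (`IsEvenApproxUnit.exists_strict_sum`).

Strictly, Σ D_k = 1 - b_0, and u_k asymptotically fixes a ∈ A₁, so M₁a ∈ J. In the other direction,
u_k a₂, u_k φ(g) and φ(g) u_k lie in J, where D_k can be made small, so M₂a₂, M₂φ(g) and φ(g)M₂ lie
in J. Each basic membership has the same proof: up to an element of J, the multiplier is the strict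
sum of a series in J whose terms are eventually O(2^{-k}). The series converges in norm and J is
closed (`StrictTendsto.memJ`). Density and closedness of J extend this to all of Δ, A₁ and A₂.

Estimates in g can only be made uniform on compact sets. The group of L²_{m'}-loops is covered by
bounded open sets, whose images in the group of L²_m-loops lie in compact sets by Rellich's theorem
(`totallyBounded_preUIncl`, `isCompact_ltCompact`). The bounds are then uniform on these open sets,
which also gives norm continuity (`StrictTendsto.memJ_and_continuous`).

Quasi-centrality and almost invariance come from explicit averages. For an approximate unit e_i, the
errors T(e_i), with T a commutator or a displacement by a group element, satisfy T(e_i)* T(e_j) → 0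
as j → ∞. Hence means over n terms of a sparse subsequence have error about n^{-1/2}
(`AsympOrthogonal.exists_average`). -/

theorem norm_sum_sq_le_of_almost_orthogonal {ι : Type*} (s : Finset ι) (x : ι → A) {C δ : ℝ}
    (hδ0 : 0 ≤ δ) (hC : ∀ i ∈ s, ‖x i‖ ≤ C)
    (hδ : ∀ i ∈ s, ∀ j ∈ s, i ≠ j → ‖star (x i) * x j‖ ≤ δ) :
    ‖∑ i ∈ s, x i‖ ^ 2 ≤ s.card * C ^ 2 + s.card ^ 2 * δ := by
  classical
  rw [sq, ← CStarRing.norm_star_mul_self, star_sum, Finset.sum_mul_sum]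
  -- After the C*-identity only the diagonal terms are large. Adding δ to them as well merely makes
  -- the count simpler.
  calc ‖∑ i ∈ s, ∑ j ∈ s, star (x i) * x j‖
      ≤ ∑ i ∈ s, ∑ j ∈ s, ((if i = j then C ^ 2 else 0) + δ) := by
        refine norm_sum_le_of_le _ fun i hi => norm_sum_le_of_le _ fun j hj => ?_
        by_cases hij : i = j
        · subst hij
          rw [CStarRing.norm_star_mul_self, if_pos rfl, ← sq]
          have := pow_le_pow_left₀ (norm_nonneg _) (hC i hi) 2
          linarith
        · rw [if_neg hij, zero_add]
          exact hδ i hi j hj hij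
    _ = s.card * C ^ 2 + s.card ^ 2 * δ := by
        have h : ∀ i ∈ s, ∑ j ∈ s, ((if i = j then C ^ 2 else 0) + δ) = C ^ 2 + s.card * δ := by
          intro i hi
          rw [Finset.sum_add_distrib, Finset.sum_ite_eq, if_pos hi]
          simp
        rw [Finset.sum_congr rfl h]
        simp
        ring

/-- The linear maps in `𝒯` take the sequence `e` to uniformly bounded sequences which are, uniformly
in `𝒯`, asymptotically orthogonal. -/
def AsympOrthogonal (e : ℕ → A) (𝒯 : Set (A →ₗ[ℂ] A)) : Prop :=
  (∀ᶠ C : ℝ in atTop, ∀ T ∈ 𝒯, ∀ i, ‖T (e i)‖ ≤ C) ∧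
    ∀ i, ∀ δ > 0, ∀ᶠ j in atTop, ∀ T ∈ 𝒯, ‖star (T (e i)) * T (e j)‖ ≤ δ

theorem AsympOrthogonal.biUnion {e : ℕ → A} {ι : Type*} {𝒯 : ι → Set (A →ₗ[ℂ] A)} {I : Set ι}
    (hI : I.Finite) (h : ∀ k ∈ I, AsympOrthogonal e (𝒯 k)) :
    AsympOrthogonal e (⋃ k ∈ I, 𝒯 k) := by
  constructor
  · filter_upwards [(eventually_all_finite hI).2 fun k hk => (h k hk).1] with C hC T hT
    obtain ⟨k, hk, hT⟩ := Set.mem_iUnion₂.1 hT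
    exact hC k hk T hT
  · intro i δ hδ
    filter_upwards [(eventually_all_finite hI).2 fun k hk => (h k hk).2 i δ hδ] with C hC T hT
    obtain ⟨k, hk, hT⟩ := Set.mem_iUnion₂.1 hT
    exact hC k hk T hT

theorem AsympOrthogonal.union {e : ℕ → A} {𝒯 𝒯' : Set (A →ₗ[ℂ] A)}
    (h : AsympOrthogonal e 𝒯) (h' : AsympOrthogonal e 𝒯') : AsympOrthogonal e (𝒯 ∪ 𝒯') := by
  rw [Set.union_eq_iUnion, ← Set.biUnion_univ]
  exact AsympOrthogonal.biUnion Set.finite_univ (by rintro (_ | _) -; exacts [h', h])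

/-- Averages of sparse subsequences are almost annihilated by `𝒯`. -/
theorem AsympOrthogonal.exists_average {e : ℕ → A} {𝒯 : Set (A →ₗ[ℂ] A)}
    (h : AsympOrthogonal e 𝒯) (N : ℕ) {ε : ℝ} (hε : 0 < ε) :
    ∃ N', ∃ b ∈ convexHull ℝ (e '' Set.Icc N N'), ∀ T ∈ 𝒯, ‖T b‖ ≤ ε := by
  obtain ⟨C, hC⟩ := h.1.exists
  -- Each new index is taken so far out that it is almost orthogonal to all the earlier ones,
  -- uniformly in `𝒯`.
  obtain ⟨f, hfN, hf⟩ := exists_seq_of_forall_finset_exists (fun i : ℕ => N ≤ i)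
    (fun i j => i < j ∧ ∀ T ∈ 𝒯, ‖star (T (e i)) * T (e j)‖ ≤ ε ^ 2 / 2) (by
      intro s _
      have h1 : ∀ᶠ j in atTop, ∀ i ∈ s,
          i < j ∧ ∀ T ∈ 𝒯, ‖star (T (e i)) * T (e j)‖ ≤ ε ^ 2 / 2 :=
        (eventually_all_finset s).2 fun i _ =>
          (eventually_gt_atTop i).and (h.2 i _ (by positivity))
      exact ((eventually_ge_atTop N).and h1).exists)
  -- The squared norm of the mean is at most C²/n + ε²/2, and this n brings the first summand below
  -- ε²/2. The maximum with 0 ensures that n is positive.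
  obtain ⟨n, hn⟩ := exists_nat_gt (max 0 (C ^ 2 / (ε ^ 2 / 2)))
  have hn0 : (0 : ℝ) < n := (le_max_left _ _).trans_lt hn
  have hn1 : C ^ 2 < n * (ε ^ 2 / 2) := by
    rw [← div_lt_iff₀ (by positivity)]
    exact (le_max_right _ _).trans_lt hn
  have hmono : StrictMono f := fun i j hij => (hf i j hij).1
  refine ⟨f n, ∑ k ∈ Finset.range n, (n : ℝ)⁻¹ • e (f k), ?_, fun T hT => ?_⟩
  · refine (convex_convexHull ℝ _).sum_mem (fun _ _ => by positivity) (by simp [hn0.ne'])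
      fun k hk => subset_convexHull ℝ _ ⟨f k, ⟨hfN k, ?_⟩, rfl⟩
    exact hmono.monotone (Finset.mem_range.1 hk).le
  · have key := norm_sum_sq_le_of_almost_orthogonal (Finset.range n) (fun k => T (e (f k)))
      (C := C) (δ := ε ^ 2 / 2) (by positivity) (fun k _ => hC T hT _) (by
        intro i _ j _ hij
        rcases lt_or_gt_of_ne hij with hij | hij
        · exact (hf i j hij).2 T hT
        · rw [← norm_star, star_mul, star_star]
          exact (hf j i hij).2 T hT)
    rw [← Finset.smul_sum, T.map_smul_of_tower, norm_smul, map_sum, Real.norm_of_nonneg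
      (by positivity), inv_mul_le_iff₀ hn0]
    refine le_of_sq_le_sq ?_ (by positivity)
    rw [Finset.card_range] at key
    nlinarith

theorem convex_norm_mul_sub_le (y : A) (ε : ℝ) :
    Convex ℝ {x : A | ‖x * y - y‖ ≤ ε} := by
  have : {x : A | ‖x * y - y‖ ≤ ε} = (LinearMap.mulRight ℝ y) ⁻¹' Metric.closedBall y ε := by
    ext x; simp [dist_eq_norm]
  rw [this]
  exact (convex_closedBall _ _).linear_preimage _

theorem convex_norm_mul_sub_le' (y : A) (ε : ℝ) :
    Convex ℝ {x : A | ‖y * x - y‖ ≤ ε} := by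
  have : {x : A | ‖y * x - y‖ ≤ ε} = (LinearMap.mulLeft ℝ y) ⁻¹' Metric.closedBall y ε := by
    ext x; simp [dist_eq_norm]
  rw [this]
  exact (convex_closedBall _ _).linear_preimage _

variable [PartialOrder A] [StarOrderedRing A]

/-- Convex combinations of the tails of an approximate unit which increase, are almost annihilated
by given maps and almost act as a unit on given sets. -/
theorem exists_monotone_seq {e : ℕ → A} (he : Monotone e)
    {𝒯 : ℕ → Set (A →ₗ[ℂ] A)} (h𝒯 : ∀ k, AsympOrthogonal e (𝒯 k)) {Y : ℕ → Set A}
    (hY : ∀ k, ∀ ε > 0, ∀ᶠ i in atTop, ∀ y ∈ Y k, ‖e i * y - y‖ ≤ ε ∧ ‖y * e i - y‖ ≤ ε)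
    {η : ℕ → ℝ} (hη : ∀ k, 0 < η k) :
    ∃ b : ℕ → A, Monotone b ∧ ∀ n, b n ∈ convexHull ℝ (e '' Set.Ici n) ∧ ∀ k ≤ n,
      (∀ T ∈ 𝒯 k, ‖T (b n)‖ ≤ η k) ∧ ∀ y ∈ Y k, ‖b n * y - y‖ ≤ η k ∧ ‖y * b n - y‖ ≤ η k := by
  -- K is the index where the previous average stopped. The next average uses only later members of
  -- the sequence.
  have stage : ∀ n K : ℕ, ∃ N' : ℕ, ∃ b : A, b ∈ convexHull ℝ (e '' Set.Icc (max n K) N') ∧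
      ∀ k ≤ n, (∀ T ∈ 𝒯 k, ‖T b‖ ≤ η k) ∧
        ∀ y ∈ Y k, ‖b * y - y‖ ≤ η k ∧ ‖y * b - y‖ ≤ η k := by
    intro n K
    have hfin : (Set.Iic n).Finite := Set.finite_Iic n
    obtain ⟨ε, hεη, hε⟩ : ∃ ε : ℝ, (∀ k ∈ Set.Iic n, ε ≤ η k) ∧ 0 < ε :=
      (((eventually_all_finite hfin).2 fun k _ =>
        (eventually_le_nhds (hη k)).filter_mono nhdsWithin_le_nhds).and
          (self_mem_nhdsWithin (s := Set.Ioi (0 : ℝ)))).exists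
    obtain ⟨N, hN⟩ := ((eventually_all_finite hfin).2 fun k _ =>
      hY k (η k) (hη k)).exists_forall_of_atTop
    obtain ⟨N', b, hb, hT⟩ := (AsympOrthogonal.biUnion hfin fun k _ => h𝒯 k).exists_average
      (max (max n K) N) hε
    refine ⟨N', b, convexHull_mono (Set.image_mono
      (Set.Icc_subset_Icc_left (le_max_left _ _))) hb, fun k hk => ⟨fun T hTk => ?_, fun y hy => ?_⟩⟩
    · exact (hT T (Set.mem_biUnion hk hTk)).trans (hεη k hk)
    · refine convexHull_min ?_ ((convex_norm_mul_sub_le y (η k)).inter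
        (convex_norm_mul_sub_le' y (η k))) hb
      rintro _ ⟨i, hi, rfl⟩
      exact hN i ((le_max_right _ _).trans hi.1) k hk y hy
  choose N' b hb hprop using stage
  -- Consecutive averages use the index blocks from N n to N (n + 1). Since `e` increases, the
  -- shared endpoint `e (N (n + 1))` separates them, and so the averages increase.
  let N : ℕ → ℕ := fun n => Nat.rec 0 N' n
  refine ⟨fun n => b n (N n), monotone_nat_of_le_succ fun n => ?_, fun n =>
    ⟨convexHull_mono (Set.image_mono ?_) (hb n (N n)), hprop n (N n)⟩⟩
  · have h1 : b n (N n) ≤ e (N (n + 1)) := by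
      refine convexHull_min ?_ (convex_Iic (𝕜 := ℝ) (e (N (n + 1)))) (hb n (N n))
      rintro _ ⟨i, hi, rfl⟩
      exact he hi.2
    have h2 : e (N (n + 1)) ≤ b (n + 1) (N (n + 1)) := by
      refine convexHull_min ?_ (convex_Ici (𝕜 := ℝ) (e (N (n + 1)))) (hb (n + 1) (N (n + 1)))
      rintro _ ⟨i, hi, rfl⟩
      exact he ((le_max_right _ _).trans hi.1)
    exact h1.trans h2
  · exact fun i hi => (le_max_left _ _).trans hi.1

end Averaging

/-! ### Square roots, commutators and positivity in C*-algebras -/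

section SquareRoot

variable {A : Type*} [CStarAlgebra A]

/-- Leibniz' rule, by induction on the degree. What matters is that L depends on p alone. -/
theorem norm_commutator_aeval_le (p : Polynomial ℝ) : ∃ L : ℝ, 0 ≤ L ∧ ∀ a x : A, ‖a‖ ≤ 1 →
    ‖Polynomial.aeval a p * x - x * Polynomial.aeval a p‖ ≤ L * ‖a * x - x * a‖ := by
  induction p using Polynomial.induction_on with
  | C r => exact ⟨0, le_rfl, fun a x _ => by simp [Algebra.commutes r x]⟩
  | add p q hp hq =>
    obtain ⟨L, hL0, hL⟩ := hp
    obtain ⟨L', hL0', hL'⟩ := hq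
    refine ⟨L + L', by positivity, fun a x ha => ?_⟩
    rw [map_add, add_mul, mul_add, add_sub_add_comm, add_mul]
    exact norm_add_le_of_le (hL a x ha) (hL' a x ha)
  | monomial n r h =>
    obtain ⟨L, hL0, hL⟩ := h
    -- The norm of 1 is kept because A may be zero.
    refine ⟨L + |r| * ‖(1 : A)‖, by positivity,
      fun a x ha => ?_⟩
    have hr : ‖Polynomial.aeval a (Polynomial.C r * Polynomial.X ^ n)‖ ≤ |r| * ‖(1 : A)‖ := by
      have hpow : ‖a ^ n‖ ≤ ‖(1 : A)‖ := by
        induction n with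
        | zero => simp
        | succ n ih =>
          rcases subsingleton_or_nontrivial A with hA | hA
          · simp [Subsingleton.elim _ (0 : A)]
          rw [norm_one]
          exact (norm_pow_le a _).trans (pow_le_one₀ (norm_nonneg _) ha)
      simp only [map_mul, Polynomial.aeval_C, map_pow, Polynomial.aeval_X]
      rw [← Algebra.smul_def, norm_smul, Real.norm_eq_abs]
      gcongr
    set y := Polynomial.aeval a (Polynomial.C r * Polynomial.X ^ n) with hy
    have hy' : Polynomial.aeval a (Polynomial.C r * Polynomial.X ^ (n + 1)) = y * a := by
      rw [hy, pow_succ, ← mul_assoc, map_mul, Polynomial.aeval_X]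
    have e1 : y * a * x - x * (y * a) = y * (a * x - x * a) + (y * x - x * y) * a := by noncomm_ring
    rw [hy', e1]
    have h1 := hL a x ha
    calc _ ≤ ‖y‖ * ‖a * x - x * a‖ + ‖y * x - x * y‖ * ‖a‖ :=
          norm_add_le_of_le (norm_mul_le _ _) (norm_mul_le _ _)
      _ ≤ (|r| * ‖(1 : A)‖) * ‖a * x - x * a‖ + (L * ‖a * x - x * a‖) * 1 := by gcongr
      _ = _ := by ring

variable [PartialOrder A] [StarOrderedRing A]

/-- If `x` almost commutes with a positive contraction `a`, then it almost commutes with `√a`. -/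
theorem exists_norm_commutator_sqrt_le {ε : ℝ} (hε : 0 < ε) : ∃ δ > 0, ∀ a x : A, 0 ≤ a →
    ‖a‖ ≤ 1 → ‖x‖ ≤ 1 → ‖a * x - x * a‖ ≤ δ → ‖CFC.sqrt a * x - x * CFC.sqrt a‖ ≤ ε := by
  -- Weierstrass on [0, 1], which contains the spectrum of a. Replacing √a by p(a) costs ε/4 on each
  -- side of the commutator, and the commutator with p(a) takes the remaining ε/2.
  obtain ⟨p, hp⟩ := exists_polynomial_near_of_continuousOn 0 1 Real.sqrt
    Real.continuous_sqrt.continuousOn (ε / 4) (by positivity)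
  obtain ⟨L, hL0, hL⟩ := norm_commutator_aeval_le (A := A) p
  refine ⟨ε / (2 * (L + 1)), by positivity, fun a x ha ha1 hx hax => ?_⟩
  have h1 : ‖CFC.sqrt a - Polynomial.aeval a p‖ ≤ ε / 4 := by
    rw [CFC.sqrt_eq_real_sqrt a ha, cfcₙ_eq_cfc, ← cfc_polynomial p a, ← cfc_sub _ _ a]
    refine norm_cfc_le (by positivity) fun t ht => ?_
    have ht0 : 0 ≤ t := spectrum_nonneg_of_nonneg ha ht
    have : Nontrivial A := by
      rw [← not_subsingleton_iff_nontrivial]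
      intro h
      simp [spectrum.of_subsingleton] at ht
    have ht1 : t ≤ 1 := (Real.le_norm_self t).trans ((spectrum.norm_le_norm_of_mem ht).trans ha1)
    rw [Real.norm_eq_abs, abs_sub_comm]
    exact (hp t ⟨ht0, ht1⟩).le
  set s := CFC.sqrt a
  set q := Polynomial.aeval a p
  have e1 : s * x - x * s = (s - q) * x + (q * x - x * q) - x * (s - q) := by noncomm_ring
  rw [e1]
  calc _ ≤ ‖s - q‖ * ‖x‖ + L * ‖a * x - x * a‖ + ‖x‖ * ‖s - q‖ :=
        norm_sub_le_of_le (norm_add_le_of_le (norm_mul_le _ _) (hL a x ha1)) (norm_mul_le _ _)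
    _ ≤ ε / 4 * 1 + (L + 1) * (ε / (2 * (L + 1))) + 1 * (ε / 4) := by
        gcongr
        linarith
    _ = ε := by field_simp; ring

/-- With its converse `norm_one_sub_le`, this trades order for norm bounds, which pass to strict
limits. -/
theorem nonneg_of_norm_one_sub_le {a : A} (ha : IsSelfAdjoint a) (h1 : ‖a‖ ≤ 1)
    (h2 : ‖1 - a‖ ≤ 1) : 0 ≤ a := by
  have h : SpectrumRestricts a ContinuousMap.realToNNReal :=
    (SpectrumRestricts.nnreal_iff_nnnorm ha (t := 1) (by exact_mod_cast h1)).2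
      (by simpa using (show ‖1 - a‖₊ ≤ 1 by exact_mod_cast h2))
  exact (StarOrderedRing.nonneg_iff_spectrum_nonneg a ha).2 (SpectrumRestricts.nnreal_iff.1 h)

theorem norm_one_sub_le {a : A} (h0 : 0 ≤ a) (h1 : ‖a‖ ≤ 1) : ‖1 - a‖ ≤ 1 := by
  have := (SpectrumRestricts.nnreal_iff_nnnorm (.of_nonneg h0) (t := 1) (by exact_mod_cast h1)).1
    (SpectrumRestricts.nnreal_of_nonneg h0)
  simpa using (show ((‖algebraMap ℝ A (1 : NNReal) - a‖₊ : NNReal) : ℝ) ≤ (1 : NNReal) by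
    exact_mod_cast this)

/-- A positive contraction satisfies x² ≤ x ≤ d; conjugate by j. This turns domination by the
increments of an approximate unit into a Cauchy estimate without any commutation. -/
theorem norm_mul_sq_le_of_le {x d : A} (hx : 0 ≤ x) (hxd : x ≤ d) (hx1 : ‖x‖ ≤ 1) (j : A) :
    ‖x * j‖ ^ 2 ≤ ‖star j * d * j‖ := by
  have hsa : star x = x := (IsSelfAdjoint.of_nonneg hx).star_eq
  have hle1 : x ≤ 1 := (CStarAlgebra.norm_le_one_iff_of_nonneg x hx).1 hx1
  have hs : CFC.sqrt x * CFC.sqrt x = x := CFC.sqrt_mul_sqrt_self x hx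
  have hs' : star (CFC.sqrt x) = CFC.sqrt x :=
    (IsSelfAdjoint.of_nonneg (CFC.sqrt_nonneg x)).star_eq
  have hxx : x * x ≤ x := by
    have := star_left_conjugate_le_conjugate hle1 (CFC.sqrt x)
    rw [hs', mul_one, hs] at this
    have e1 : CFC.sqrt x * x * CFC.sqrt x = x * x := by
      calc _ = CFC.sqrt x * (CFC.sqrt x * CFC.sqrt x) * CFC.sqrt x := by rw [hs]
        _ = (CFC.sqrt x * CFC.sqrt x) * (CFC.sqrt x * CFC.sqrt x) := by noncomm_ring
        _ = x * x := by rw [hs]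
    rwa [e1] at this
  rw [sq, ← CStarRing.norm_star_mul_self, star_mul, hsa]
  have h2 : star j * x * (x * j) ≤ star j * d * j := by
    have := star_left_conjugate_le_conjugate (hxx.trans hxd) j
    simpa [mul_assoc] using this
  refine CStarAlgebra.norm_le_norm_of_nonneg_of_le ?_ h2
  have := star_mul_self_nonneg (x * j)
  rwa [star_mul, hsa] at this

end SquareRoot

/-! ### Rellich compactness for the loop groups -/

section Rellich

/-- Pull back a finite net of the image: points with the same nearby net point are close up to the
error ε. It will be used with truncations of Fourier series. -/
theorem totallyBounded_of_approx {X : Type*} [PseudoMetricSpace X] {s : Set X}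
    (h : ∀ ε > 0, ∃ (F : Type) (_ : PseudoMetricSpace F) (p : X → F) (C : ℝ), 0 ≤ C ∧
      TotallyBounded (p '' s) ∧ ∀ x ∈ s, ∀ y ∈ s, dist x y ≤ C * dist (p x) (p y) + ε) :
    TotallyBounded s := by
  refine Metric.totallyBounded_of_finite_discretization fun ε hε => ?_
  obtain ⟨F, _, p, C, hC, hp, hd⟩ := h (ε / 2) (by positivity)
  obtain ⟨t, ht, hcov⟩ := Metric.totallyBounded_iff.1 hp (ε / (8 * (C + 1))) (by positivity)
  have hch : ∀ x : s, ∃ y : t, dist (p x) y < ε / (8 * (C + 1)) := by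
    intro x
    obtain ⟨y, hy, hxy⟩ := Set.mem_iUnion₂.1 (hcov ⟨x, x.2, rfl⟩)
    exact ⟨⟨y, hy⟩, hxy⟩
  choose f hf using hch
  have : Fintype t := ht.fintype
  let ψ := Fintype.equivFin t
  refine ⟨ULift (Fin (Fintype.card t)), inferInstance, fun x => ⟨ψ (f x)⟩, fun x y hxy => ?_⟩
  have hxy' : f x = f y := ψ.injective (ULift.up_injective hxy)
  have h1 := hf x
  have h2 := hf y
  rw [← hxy'] at h2
  have h3 : dist (p x) (p y) ≤ 2 * (ε / (8 * (C + 1))) := by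
    linarith [dist_triangle_right (p x) (p y) (f x)]
  calc dist (x : X) y ≤ C * dist (p x) (p y) + ε / 2 := hd x x.2 y y.2
    _ ≤ (C + 1) * (2 * (ε / (8 * (C + 1)))) + ε / 2 := by gcongr; linarith
    _ = ε / 4 + ε / 2 := by field_simp; ring
    _ < ε := by linarith

theorem summable_sobolev (s : ℝ) (f : smoothMeanZero) :
    Summable fun n : ℤ => (|(n : ℝ)| ^ s * ‖fourierC f n‖) ^ 2 := by
  have := (memℓp_gen_iff (by simp)).1 (memlp_weighted s f)
  refine this.congr fun n => ?_
  simp only [ENNReal.toReal_ofNat, Real.rpow_ofNat, norm_mul, Complex.norm_real]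
  rw [Real.norm_of_nonneg (by positivity)]

theorem norm_fourierC_le {s : ℝ} (hs : 0 ≤ s) (f : smoothMeanZero) (n : ℤ) :
    ‖fourierC f n‖ ≤ ‖sobolevMap s f‖ := by
  rcases eq_or_ne n 0 with rfl | hn
  · simp [fourierC_zero_of_mem f.2]
  refine le_of_sq_le_sq ?_ (norm_nonneg _)
  have h1 : (1 : ℝ) ≤ |(n : ℝ)| ^ s :=
    Real.one_le_rpow (by exact_mod_cast Int.one_le_abs hn) hs
  have h2 := (summable_sobolev s f).le_tsum n fun _ _ => by positivity
  rw [norm_sobolevMap_sq]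
  calc ‖fourierC f n‖ ^ 2 ≤ (|(n : ℝ)| ^ s * ‖fourierC f n‖) ^ 2 := by
        gcongr
        exact le_mul_of_one_le_left (norm_nonneg _) h1
    _ ≤ _ := by
        have : 0 ≤ (|(n : ℝ)| ^ s * ‖fourierC f n‖) ^ 2 := by positivity
        linarith

/-- The high frequencies contribute little to the weaker Sobolev norm. -/
theorem norm_sobolevMap_sq_le {m m' : ℝ} (h : m ≤ m') {N : ℕ} (hN : 0 < N) (f : smoothMeanZero) :
    ‖sobolevMap m f‖ ^ 2 ≤
      2 * ∑ n ∈ Finset.Icc (-N : ℤ) N, (|(n : ℝ)| ^ m * ‖fourierC f n‖) ^ 2 +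
        ((N : ℝ) ^ (m - m') * ‖sobolevMap m' f‖) ^ 2 := by
  classical
  rw [mul_pow, norm_sobolevMap_sq, norm_sobolevMap_sq, mul_left_comm, ← mul_add]
  refine mul_le_mul_of_nonneg_left ?_ zero_le_two
  have hs1 : HasSum (fun n : ℤ => if n ∈ Finset.Icc (-N : ℤ) N then
      (|(n : ℝ)| ^ m * ‖fourierC f n‖) ^ 2 else 0)
      (∑ n ∈ Finset.Icc (-N : ℤ) N, (|(n : ℝ)| ^ m * ‖fourierC f n‖) ^ 2) := by
    rw [← Finset.sum_congr rfl fun n hn => if_pos (c := n ∈ Finset.Icc (-N : ℤ) N) hn]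
    exact hasSum_sum_of_ne_finset_zero fun n hn => if_neg hn
  have hs2 := ((summable_sobolev m' f).hasSum).mul_left (((N : ℝ) ^ (m - m')) ^ 2)
  refine hasSum_le (fun n => ?_) (summable_sobolev m f).hasSum (hs1.add hs2)
  by_cases hn : n ∈ Finset.Icc (-N : ℤ) N
  · rw [if_pos hn]
    exact le_add_of_nonneg_right (by positivity)
  · rw [if_neg hn, zero_add, ← mul_pow, ← mul_assoc]
    have hn' : (N : ℤ) < |n| := by
      rw [Finset.mem_Icc, ← abs_le] at hn
      exact not_le.1 hn
    have hn1 : (N : ℝ) ≤ |(n : ℝ)| := by exact_mod_cast hn'.le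
    have hN0 : (0 : ℝ) < N := by exact_mod_cast hN
    refine pow_le_pow_left₀ (by positivity) (mul_le_mul_of_nonneg_right ?_ (norm_nonneg _)) 2
    calc |(n : ℝ)| ^ m = |(n : ℝ)| ^ (m - m') * |(n : ℝ)| ^ m' := by
          rw [← Real.rpow_add (hN0.trans_le hn1)]; simp
      _ ≤ (N : ℝ) ^ (m - m') * |(n : ℝ)| ^ m' :=
          mul_le_mul_of_nonneg_right (Real.rpow_le_rpow_of_nonpos hN0 hn1 (by linarith))
            (by positivity)

/-- Rellich's theorem for smooth functions. -/
theorem totallyBounded_preUIncl {m m' : ℝ} (hm' : 0 ≤ m') (h : m < m') (R : ℝ) :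
    TotallyBounded (preUIncl h.le '' Metric.closedBall 0 R) := by
  refine totallyBounded_of_approx fun ε hε => ?_
  -- Two points of the ball differ by at most 2R in the stronger norm, so this bounds the part of
  -- their difference with frequencies above N.
  have hlim : Tendsto (fun N : ℕ => (N : ℝ) ^ (m - m') * (2 * R)) atTop (𝓝 0) := by
    have := ((tendsto_rpow_neg_atTop (sub_pos.2 h)).comp
      tendsto_natCast_atTop_atTop).mul_const (2 * R)
    simpa using this
  obtain ⟨N, hN0, hN⟩ := ((eventually_gt_atTop 0).and (hlim.eventually_le_const hε)).exists
  set C : ℝ := 2 * ∑ n ∈ Finset.Icc (-N : ℤ) N, (|(n : ℝ)| ^ m) ^ 2 with hC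
  have hC0 : 0 ≤ C := by positivity
  -- The map is truncation to frequencies |n| ≤ N. Its image lies in a ball of a finite-dimensional
  -- space, and √C compares the weighted ℓ²-norm there with the supremum norm.
  refine ⟨Finset.Icc (-N : ℤ) N → ℂ, inferInstance,
    fun f n => fourierC (show smoothMeanZero from f) n, Real.sqrt C, by positivity, ?_, ?_⟩
  · refine (isCompact_closedBall 0 R).totallyBounded.subset ?_
    rintro _ ⟨_, ⟨f, hf, rfl⟩, rfl⟩
    rw [mem_closedBall_zero_iff] at hf ⊢
    have hR : 0 ≤ R := (norm_nonneg _).trans hf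
    exact (pi_norm_le_iff_of_nonneg hR).2 fun n =>
      (norm_fourierC_le hm' (show smoothMeanZero from f) n).trans hf
  · rintro _ ⟨f, hf, rfl⟩ _ ⟨g, hg, rfl⟩
    rw [mem_closedBall_zero_iff] at hf hg
    set f' : smoothMeanZero := f with hf'
    set g' : smoothMeanZero := g with hg'
    have hsub : ∀ n, fourierC (f' - g' : smoothMeanZero) n = fourierC f' n - fourierC g' n := by
      intro n
      have h1 : ((f' - g' : smoothMeanZero) : ℝ → ℝ) = f' + ((-1 : ℝ) • (g' : ℝ → ℝ)) := by
        ext x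
        simp [sub_eq_add_neg]
      rw [h1, fourierC_add f'.2.1.continuous (g'.2.1.continuous.const_smul (-1 : ℝ)),
        fourierC_smul]
      push_cast
      ring
    set p : PreU m → Finset.Icc (-N : ℤ) N → ℂ :=
      fun f n => fourierC (show smoothMeanZero from f) n with hp
    set D := dist (p (preUIncl h.le f)) (p (preUIncl h.le g)) with hD
    have hD0 : 0 ≤ D := dist_nonneg
    have hDn : ∀ n ∈ Finset.Icc (-N : ℤ) N, ‖fourierC (f' - g' : smoothMeanZero) n‖ ≤ D := by
      intro n hn
      rw [hsub n, ← dist_eq_norm]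
      exact dist_le_pi_dist (p (preUIncl h.le f)) (p (preUIncl h.le g)) ⟨n, hn⟩
    have hR : ‖sobolevMap m' (f' - g')‖ ≤ 2 * R := by
      have : ‖f - g‖ ≤ R + R := norm_sub_le_of_le hf hg
      exact this.trans_eq (two_mul R).symm
    have key := norm_sobolevMap_sq_le h.le hN0 (f' - g')
    have h1 : 2 * ∑ n ∈ Finset.Icc (-N : ℤ) N,
        (|(n : ℝ)| ^ m * ‖fourierC (f' - g' : smoothMeanZero) n‖) ^ 2 ≤ (Real.sqrt C * D) ^ 2 := by
      rw [mul_pow, Real.sq_sqrt hC0, hC, mul_assoc, Finset.sum_mul]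
      refine mul_le_mul_of_nonneg_left (Finset.sum_le_sum fun n hn => ?_) zero_le_two
      rw [← mul_pow]
      gcongr
      exact hDn n hn
    have h2 : ((N : ℝ) ^ (m - m') * ‖sobolevMap m' (f' - g')‖) ^ 2 ≤ ε ^ 2 := by
      refine pow_le_pow_left₀ (by positivity) (le_trans ?_ hN) 2
      gcongr
    rw [dist_eq_norm]
    change ‖sobolevMap m (f' - g')‖ ≤ _
    refine le_of_sq_le_sq ?_ (by positivity)
    have h3 : 0 ≤ Real.sqrt C * D * ε := by positivity
    linarith [add_sq (Real.sqrt C * D) ε]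

theorem isCompact_closure_uIncl {m m' : ℝ} (hm' : 0 ≤ m') (h : m < m') (R : ℝ) :
    IsCompact (closure (uIncl h.le '' Metric.closedBall 0 R)) := by
  have h1 : TotallyBounded
      (((↑) : PreU m → U m) '' (preUIncl h.le '' Metric.closedBall 0 (R + 1))) :=
    (totallyBounded_preUIncl hm' h (R + 1)).image (UniformSpace.Completion.uniformContinuous_coe _)
  have h2 : uIncl h.le '' Metric.closedBall 0 R ⊆ closure
      (((↑) : PreU m → U m) '' (preUIncl h.le '' Metric.closedBall 0 (R + 1))) := by
    -- Density approximates points of an open ball by smooth functions in it, so the radius is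
    -- enlarged from R to R + 1.
    have h3 : (Metric.closedBall 0 R : Set (U m')) ⊆
        closure (((↑) : PreU m' → U m') '' Metric.closedBall 0 (R + 1)) := by
      refine (Metric.closedBall_subset_ball (lt_add_one R)).trans
        ((UniformSpace.Completion.denseRange_coe.open_subset_closure_inter
          Metric.isOpen_ball).trans (closure_mono ?_))
      rintro _ ⟨hx, f, rfl⟩
      refine ⟨f, ?_, rfl⟩
      rw [mem_ball_zero_iff, UniformSpace.Completion.norm_coe] at hx
      exact mem_closedBall_zero_iff.2 hx.le
    refine (Set.image_mono h3).trans ((image_closure_subset_closure_image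
      (uIncl h.le).continuous).trans (closure_mono ?_))
    rintro _ ⟨_, ⟨f, hf, rfl⟩, rfl⟩
    exact ⟨_, ⟨f, hf, rfl⟩, ((preUIncl h.le).completion_coe f).symm⟩
  exact (h1.closure.subset h2).closure.isCompact_of_isClosed isClosed_closure

theorem isClosed_piT : IsClosed (PiT : Set ℝ) := by
  have : (PiT : Set ℝ) = Circle.exp ⁻¹' {1} := by
    ext x
    rfl
  rw [this]
  exact isClosed_singleton.preimage Circle.exp.continuous

theorem toAdd_ltIncl_snd_snd {m m' : ℝ} (h : m ≤ m') (g : LT m') :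
    (ltIncl h g).2.2.toAdd = uIncl h g.2.2.toAdd := rfl

theorem uIncl_mem_closure {m m' : ℝ} (h : m ≤ m') {n : ℝ} {x : U m'} (hx : ‖x‖ < n) :
    uIncl h x ∈ closure (uIncl h '' Metric.closedBall 0 n) :=
  subset_closure (Set.mem_image_of_mem _ (mem_closedBall_zero_iff.2 hx.le))

theorem toAdd_ltIncl_snd_snd_mem {m m' : ℝ} (h : m ≤ m') {n : ℝ} {g : LT m'}
    (hg : ‖g.2.2.toAdd‖ < n) :
    (ltIncl h g).2.2.toAdd ∈ closure (uIncl h '' Metric.closedBall 0 n) := by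
  rw [toAdd_ltIncl_snd_snd]
  exact uIncl_mem_closure h hg

theorem isCompact_setOf_toAdd_mem {X : Type*} [TopologicalSpace X] {s : Set X}
    (hs : IsCompact s) : IsCompact {t : Multiplicative X | t.toAdd ∈ s} := by
  have h1 := hs.image continuous_ofAdd
  rwa [Equiv.image_eq_preimage_symm] at h1

theorem isCompact_piT_norm_le (n : ℝ) : IsCompact {t : PiT | ‖(t : ℝ)‖ ≤ n} := by
  have : IsCompact (((↑) : PiT → ℝ) ⁻¹' Metric.closedBall 0 n) :=
    isClosed_piT.isClosedEmbedding_subtypeVal.isCompact_preimage (isCompact_closedBall 0 n)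
  convert this using 1
  ext t
  simp

/-- A bounded open subset of `LT_{L²_m}`. -/
def ltBall (m n : ℝ) : Set (LT m) := {g | ‖(g.2.1.toAdd : ℝ)‖ < n ∧ ‖g.2.2.toAdd‖ < n}

/-- The compact subset of `LT_{L²_m}` that contains the image of a bounded subset of
`LT_{L²_{m'}}`. -/
def ltCompact {m m' : ℝ} (h : m ≤ m') (n : ℝ) : Set (LT m) :=
  Set.univ ×ˢ {t | t.toAdd ∈ {t : PiT | ‖(t : ℝ)‖ ≤ n}} ×ˢ
    {t | t.toAdd ∈ closure (uIncl h '' Metric.closedBall 0 n)}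

theorem isOpen_ltBall (m n : ℝ) : IsOpen (ltBall m n) := by
  refine IsOpen.and (isOpen_lt ?_ continuous_const) (isOpen_lt ?_ continuous_const)
  · exact (continuous_subtype_val.comp (continuous_toAdd.comp
      (continuous_fst.comp continuous_snd))).norm
  · exact (continuous_toAdd.comp (continuous_snd.comp continuous_snd)).norm

theorem exists_mem_ltBall {m : ℝ} (g : LT m) : ∃ n : ℕ, g ∈ ltBall m n := by
  obtain ⟨n, hn⟩ := exists_nat_gt (max ‖(g.2.1.toAdd : ℝ)‖ ‖g.2.2.toAdd‖)
  exact ⟨n, (le_max_left _ _).trans_lt hn, (le_max_right _ _).trans_lt hn⟩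

theorem isCompact_ltCompact {m m' : ℝ} (hm' : 0 ≤ m') (h : m < m') (n : ℝ) :
    IsCompact (ltCompact h.le n) :=
  isCompact_univ.prod ((isCompact_setOf_toAdd_mem (isCompact_piT_norm_le n)).prod
    (isCompact_setOf_toAdd_mem (isCompact_closure_uIncl hm' h n)))

theorem ltCompact_mono {m m' : ℝ} (h : m ≤ m') : Monotone (ltCompact h) := fun _ _ hij =>
  Set.prod_mono le_rfl (Set.prod_mono (fun _ ht => le_trans (α := ℝ) ht hij) fun _ ht =>
    closure_mono (Set.image_mono (Metric.closedBall_subset_closedBall hij)) ht)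

theorem ltIncl_snd_fst {m m' : ℝ} (h : m ≤ m') (g : LT m') : (ltIncl h g).2.1 = g.2.1 := by
  rw [ltIncl, MonoidHom.coe_prodMap, Prod.map_snd, MonoidHom.coe_prodMap, Prod.map_fst,
    MonoidHom.id_apply]

theorem mem_ltCompact {m m' : ℝ} {h : m ≤ m'} {n : ℝ} {g : LT m} : g ∈ ltCompact h n ↔
    ‖(g.2.1.toAdd : ℝ)‖ ≤ n ∧ g.2.2.toAdd ∈ closure (uIncl h '' Metric.closedBall 0 n) := by
  unfold ltCompact
  rw [Set.mem_prod, Set.mem_prod]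
  exact ⟨fun h => ⟨h.2.1, h.2.2⟩, fun h => ⟨Set.mem_univ _, h.1, h.2⟩⟩

theorem ltIncl_mem_ltCompact {m m' : ℝ} (h : m ≤ m') {n : ℝ} {g : LT m'} (hg : g ∈ ltBall m' n) :
    ltIncl h g ∈ ltCompact h n := by
  refine mem_ltCompact.2 ⟨?_, toAdd_ltIncl_snd_snd_mem h hg.2⟩
  rw [ltIncl_snd_fst]
  exact hg.1.le

end Rellich

/-! ### The multiplier algebra: J as an ideal, automorphisms, grading -/

section MultiplierBasics

variable {J : Type*} [NonUnitalCStarAlgebra J]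

/-- Only centrality is part of the data of a double centralizer. That its left component is right
J-linear follows because z*z = 0 forces z = 0 in J. -/
theorem mul_coe (x : 𝓜(ℂ, J)) (a : J) : x * (a : 𝓜(ℂ, J)) = (x.fst a : J) := by
  refine DoubleCentralizer.ext _ _ _ _ (Prod.ext ?_ ?_) <;> ext b
  · change x.fst (a * b) = x.fst a * b
    refine eq_of_sub_eq_zero ?_
    rw [← CStarRing.star_mul_self_eq_zero_iff]
    generalize star (x.fst (a * b) - x.fst a * b) = c
    rw [mul_sub, ← x.central, ← mul_assoc, ← mul_assoc, ← x.central, sub_self]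
  · change x.snd b * a = b * x.fst a
    exact x.central b a

theorem coe_mul (x : 𝓜(ℂ, J)) (a : J) : (a : 𝓜(ℂ, J)) * x = (x.snd a : J) := by
  refine DoubleCentralizer.ext _ _ _ _ (Prod.ext ?_ ?_) <;> ext b
  · change a * x.fst b = x.snd a * b
    exact (x.central a b).symm
  · change x.snd (b * a) = b * x.snd a
    refine eq_of_sub_eq_zero ?_
    rw [← CStarRing.mul_star_self_eq_zero_iff]
    generalize star (x.snd (b * a) - b * x.snd a) = c
    rw [sub_mul, x.central, mul_assoc, mul_assoc, x.central, sub_self]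

theorem norm_coe (a : J) : ‖(a : 𝓜(ℂ, J))‖ = ‖a‖ := by
  refine NonUnitalStarAlgHom.norm_map (DoubleCentralizer.coeHom (𝕜 := ℂ) (A := J)) ?_ a
  rw [injective_iff_map_eq_zero]
  intro b hb
  have h : (DoubleCentralizer.coe ℂ b).fst (star b) = 0 := by
    change (DoubleCentralizer.coeHom b : 𝓜(ℂ, J)).fst (star b) = 0
    rw [hb]
    rfl
  exact (CStarRing.mul_star_self_eq_zero_iff b).1 h

theorem isometry_coe : Isometry (DoubleCentralizer.coe ℂ : J → 𝓜(ℂ, J)) :=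
  AddMonoidHomClass.isometry_of_norm (DoubleCentralizer.coeHom (𝕜 := ℂ) (A := J)) norm_coe

theorem ext_coe {x y : 𝓜(ℂ, J)} (h : ∀ j : J, x * (j : 𝓜(ℂ, J)) = y * (j : 𝓜(ℂ, J))) : x = y := by
  have h0 : x.fst = y.fst := by
    ext j
    have := h j
    rw [mul_coe, mul_coe] at this
    exact isometry_coe.injective this
  have h1 : ‖x - y‖ = 0 := by
    rw [← DoubleCentralizer.norm_fst, DoubleCentralizer.sub_fst, h0, sub_self, norm_zero]
  exact sub_eq_zero.1 (norm_eq_zero.1 h1)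

/-- The ideal `J` of its multiplier algebra. -/
noncomputable def ideal (J : Type*) [NonUnitalCStarAlgebra J] : NonUnitalStarSubalgebra ℂ 𝓜(ℂ, J) :=
  NonUnitalStarAlgHom.range (DoubleCentralizer.coeHom (𝕜 := ℂ) (A := J))

theorem memJ_coe (a : J) : MemJ (a : 𝓜(ℂ, J)) := ⟨a, rfl⟩

theorem MemJ.mul_left {y : 𝓜(ℂ, J)} (hy : MemJ y) (x : 𝓜(ℂ, J)) : MemJ (x * y) := by
  obtain ⟨a, rfl⟩ := hy
  exact ⟨_, (mul_coe x a).symm⟩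

theorem MemJ.mul_right {y : 𝓜(ℂ, J)} (hy : MemJ y) (x : 𝓜(ℂ, J)) : MemJ (y * x) := by
  obtain ⟨a, rfl⟩ := hy
  exact ⟨_, (coe_mul x a).symm⟩

theorem MemJ.add {x y : 𝓜(ℂ, J)} (hx : MemJ x) (hy : MemJ y) : MemJ (x + y) :=
  (ideal J).add_mem hx hy

theorem MemJ.neg {x : 𝓜(ℂ, J)} (hx : MemJ x) : MemJ (-x) := by
  simpa using hx.mul_left (-1)

theorem MemJ.sub {x y : 𝓜(ℂ, J)} (hx : MemJ x) (hy : MemJ y) : MemJ (x - y) := by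
  simpa [sub_eq_add_neg] using hx.add hy.neg

theorem MemJ.star {x : 𝓜(ℂ, J)} (hx : MemJ x) : MemJ (star x) := star_mem (s := ideal J) hx

theorem isClosed_memJ : IsClosed {x : 𝓜(ℂ, J) | MemJ x} :=
  (isometry_coe (J := J)).isClosedEmbedding.isClosed_range

theorem MemJ.tsum {Z : ℕ → 𝓜(ℂ, J)} (hZ : ∀ k, MemJ (Z k)) (hs : Summable Z) :
    MemJ (∑' k, Z k) :=
  isClosed_memJ.mem_of_tendsto hs.hasSum.tendsto_sum_nat
    (Eventually.of_forall fun _ => sum_mem (S := ideal J) fun k _ => hZ k)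

/-- The extension of an automorphism to the multiplier algebra is a `*`-homomorphism. -/
noncomputable def extendHom (α : J ≃⋆ₐ[ℂ] J) : 𝓜(ℂ, J) →⋆ₐ[ℂ] 𝓜(ℂ, J) where
  toFun := extendAut α
  map_one' := by
    refine DoubleCentralizer.ext _ _ _ _ (Prod.ext ?_ ?_) <;> ext b <;>
      simp [extendAut, autCLM]
  map_mul' x y := by
    refine DoubleCentralizer.ext _ _ _ _ (Prod.ext ?_ ?_) <;> ext b <;>
      simp [extendAut, autCLM]
  map_zero' := by
    refine DoubleCentralizer.ext _ _ _ _ (Prod.ext ?_ ?_) <;> ext b <;>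
      simp [extendAut, autCLM]
  map_add' x y := by
    refine DoubleCentralizer.ext _ _ _ _ (Prod.ext ?_ ?_) <;> ext b <;>
      simp [extendAut, autCLM]
  commutes' r := by
    refine DoubleCentralizer.ext _ _ _ _ (Prod.ext ?_ ?_) <;> ext b <;>
      simp [extendAut, autCLM, Algebra.algebraMap_eq_smul_one]
  map_star' x := by
    refine DoubleCentralizer.ext _ _ _ _ (Prod.ext ?_ ?_) <;> ext b <;>
      simp [extendAut, autCLM, map_star]

theorem extendAut_comp (α β γ : J ≃⋆ₐ[ℂ] J) (h : ∀ a, α (β a) = γ a) (x : 𝓜(ℂ, J)) :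
    extendAut α (extendAut β x) = extendAut γ x := by
  have hs : ∀ a, β.symm (α.symm a) = γ.symm a := by
    intro a
    apply EquivLike.injective γ
    rw [← h, StarAlgEquiv.apply_symm_apply, StarAlgEquiv.apply_symm_apply,
      StarAlgEquiv.apply_symm_apply]
  refine DoubleCentralizer.ext _ _ _ _ (Prod.ext ?_ ?_) <;> ext b <;>
    simp [extendAut, autCLM, h, hs]

theorem extendAut_refl (x : 𝓜(ℂ, J)) (γ : J ≃⋆ₐ[ℂ] J) (h : ∀ a, γ a = a) :
    extendAut γ x = x := by
  have hs : ∀ a, γ.symm a = a := fun a => by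
    apply EquivLike.injective γ
    rw [StarAlgEquiv.apply_symm_apply, h]
  refine DoubleCentralizer.ext _ _ _ _ (Prod.ext ?_ ?_) <;> ext b <;>
    simp [extendAut, autCLM, h, hs]

/-- The extension of α⁻¹ is a left inverse, and injective *-homomorphisms of C*-algebras are
isometric. -/
theorem norm_extendAut (α : J ≃⋆ₐ[ℂ] J) (x : 𝓜(ℂ, J)) : ‖extendAut α x‖ = ‖x‖ := by
  refine NonUnitalStarAlgHom.norm_map (extendHom α) (fun y z hyz => ?_) x
  have := congrArg (extendAut α.symm) hyz
  change extendAut α.symm (extendAut α y) = extendAut α.symm (extendAut α z) at this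
  rwa [extendAut_comp _ _ (StarAlgEquiv.refl ..) (by simp), extendAut_refl _ _ (by simp),
    extendAut_comp _ _ (StarAlgEquiv.refl ..) (by simp), extendAut_refl _ _ (by simp)] at this

variable {G : Type*} [Group G] [TopologicalSpace G] (E : GAlgebra G J)

/-- The action of `g` on the multiplier algebra as a `*`-homomorphism. -/
noncomputable def actHom (g : G) : 𝓜(ℂ, J) →⋆ₐ[ℂ] 𝓜(ℂ, J) := extendHom (E.act g)

theorem mAct_eq (g : G) (x : 𝓜(ℂ, J)) : mAct E g x = actHom E g x := rfl

/-- The grading of the multiplier algebra as a `*`-homomorphism. -/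
noncomputable def gradHom : 𝓜(ℂ, J) →⋆ₐ[ℂ] 𝓜(ℂ, J) := extendHom E.grading

theorem mGrading_eq (x : 𝓜(ℂ, J)) : mGrading E x = gradHom E x := rfl

theorem actHom_coe (g : G) (a : J) : actHom E g (a : 𝓜(ℂ, J)) = (E.act g a : J) :=
  extendAut_coe _ a

theorem gradHom_coe (a : J) : gradHom E (a : 𝓜(ℂ, J)) = (E.grading a : J) := extendAut_coe _ a

theorem norm_actHom (g : G) (x : 𝓜(ℂ, J)) : ‖actHom E g x‖ = ‖x‖ := norm_extendAut _ x

theorem norm_gradHom (x : 𝓜(ℂ, J)) : ‖gradHom E x‖ = ‖x‖ := norm_extendAut _ x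

theorem actHom_inv_actHom (g : G) (x : 𝓜(ℂ, J)) : actHom E g⁻¹ (actHom E g x) = x := by
  have h := extendAut_comp (E.act g⁻¹) (E.act g) 1
    (fun a => by rw [← StarAlgEquiv.mul_apply, ← map_mul, inv_mul_cancel, map_one]) x
  exact h.trans (extendAut_refl x 1 fun _ => rfl)

theorem actHom_actHom_inv (g : G) (x : 𝓜(ℂ, J)) : actHom E g (actHom E g⁻¹ x) = x := by
  simpa using actHom_inv_actHom E g⁻¹ x

theorem gradHom_gradHom (x : 𝓜(ℂ, J)) : gradHom E (gradHom E x) = x :=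
  (extendAut_comp E.grading E.grading 1 (fun a => E.grading_grading a) x).trans
    (extendAut_refl x 1 fun _ => rfl)

theorem MemJ.actHom {x : 𝓜(ℂ, J)} (hx : MemJ x) (g : G) : MemJ (actHom E g x) := by
  obtain ⟨a, rfl⟩ := hx
  exact ⟨_, (actHom_coe E g a).symm⟩

/-- This puts J on the same footing as A₁, so that one construction of approximate units serves
both. -/
theorem isGSubalgebra_ideal : IsGSubalgebra E (ideal J) := by
  refine ⟨?_, ?_, ?_⟩
  · rintro _ ⟨a, rfl⟩
    exact ⟨_, (gradHom_coe E a).symm⟩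
  · rintro g _ ⟨a, rfl⟩
    exact ⟨_, (actHom_coe E g a).symm⟩
  · rintro _ ⟨a, rfl⟩
    have : (fun g => mAct E g (DoubleCentralizer.coeHom a : 𝓜(ℂ, J))) =
        fun g => ((E.act g a : J) : 𝓜(ℂ, J)) := funext fun g => actHom_coe E g a
    change Continuous fun g => mAct E g (DoubleCentralizer.coeHom a : 𝓜(ℂ, J))
    rw [this]
    exact isometry_coe.continuous.comp (E.continuous_act a)

theorem gradedComm_of_even {x : 𝓜(ℂ, J)} (hx : IsEven E x) (y : 𝓜(ℂ, J)) :
    gradedComm E x y = x * y - y * x := by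
  have h1 : evenPart E x = x := by
    rw [evenPart, hx, ← two_smul ℂ x, smul_smul]
    norm_num
  have h2 : oddPart E x = 0 := by rw [oddPart, hx, sub_self, smul_zero]
  have h3 : evenPart E y + oddPart E y = y := by
    rw [evenPart, oddPart, ← smul_add, add_add_sub_cancel, ← two_smul ℂ y, smul_smul]
    norm_num
  rw [gradedComm, h1, h2, mul_zero, mul_zero, add_zero, sub_zero, ← add_mul, h3]

theorem evenPart_add_oddPart (x : 𝓜(ℂ, J)) : evenPart E x + oddPart E x = x := by
  rw [evenPart, oddPart, ← smul_add, add_add_sub_cancel, ← two_smul ℂ x, smul_smul]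
  norm_num

/-- The sign is absorbed by the grading automorphism, which is -1 on odd elements. In this form y
need not be split, only twisted. -/
theorem gradedComm_eq (x y : 𝓜(ℂ, J)) :
    gradedComm E x y = x * y - (y * evenPart E x + gradHom E y * oddPart E x) := by
  have h1 := evenPart_add_oddPart E y
  have h2 : gradHom E y = evenPart E y - oddPart E y := by
    rw [evenPart, oddPart, ← smul_sub, add_sub_sub_cancel, mGrading_eq, ← two_smul ℂ (gradHom E y),
      smul_smul]
    norm_num
  rw [gradedComm, h2]
  have h3 : y * evenPart E x = (evenPart E y + oddPart E y) * evenPart E x := by rw [h1]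
  rw [h3]
  noncomm_ring

end MultiplierBasics

/-! ### Strict convergence and membership in J -/

section StrictLimits

attribute [local instance] CStarAlgebra.spectralOrder CStarAlgebra.spectralOrderedRing

variable {J : Type*} [NonUnitalCStarAlgebra J]

/-- Strict convergence of a sequence of multipliers. -/
def StrictTendsto (S : ℕ → 𝓜(ℂ, J)) (X : 𝓜(ℂ, J)) : Prop :=
  ∀ y : 𝓜(ℂ, J), MemJ y → Tendsto (fun n => S n * y) atTop (𝓝 (X * y)) ∧
    Tendsto (fun n => y * S n) atTop (𝓝 (y * X))

/-- The left and right actions on J converge pointwise. The limits are bounded by Banach–Steinhaus,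
and centrality passes to the limit. -/
theorem exists_strictTendsto {S : ℕ → 𝓜(ℂ, J)}
    (h : ∀ y : 𝓜(ℂ, J), MemJ y → CauchySeq (fun n => S n * y) ∧ CauchySeq fun n => y * S n) :
    ∃ X, StrictTendsto S X := by
  have hL : ∀ j : J, ∃ l, Tendsto (fun n => (S n).fst j) atTop (𝓝 l) := by
    intro j
    refine cauchySeq_tendsto_of_complete ?_
    have := (h _ (memJ_coe j)).1
    simp only [mul_coe] at this
    exact isometry_coe.isUniformInducing.cauchy_map_iff.1 (by rwa [Filter.map_map])
  have hR : ∀ j : J, ∃ l, Tendsto (fun n => (S n).snd j) atTop (𝓝 l) := by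
    intro j
    refine cauchySeq_tendsto_of_complete ?_
    have := (h _ (memJ_coe j)).2
    simp only [coe_mul] at this
    exact isometry_coe.isUniformInducing.cauchy_map_iff.1 (by rwa [Filter.map_map])
  choose L hL using hL
  choose R hR using hR
  let L' : J →L[ℂ] J := continuousLinearMapOfTendsto (fun n => (S n).fst) (tendsto_pi_nhds.2 hL)
  let R' : J →L[ℂ] J := continuousLinearMapOfTendsto (fun n => (S n).snd) (tendsto_pi_nhds.2 hR)
  let X : 𝓜(ℂ, J) :=
    { fst := L'
      snd := R'
      central := fun a b => tendsto_nhds_unique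
        (((hR a).mul_const b).congr fun n => (S n).central a b) ((hL b).const_mul a) }
  refine ⟨X, ?_⟩
  rintro _ ⟨j, rfl⟩
  simp only [mul_coe, coe_mul]
  exact ⟨(isometry_coe.continuous.tendsto _).comp (hL j),
    (isometry_coe.continuous.tendsto _).comp (hR j)⟩

theorem StrictTendsto.of_tendsto {S : ℕ → 𝓜(ℂ, J)} {X : 𝓜(ℂ, J)} (h : Tendsto S atTop (𝓝 X)) :
    StrictTendsto S X := fun y _ => ⟨h.mul_const y, h.const_mul y⟩

theorem StrictTendsto.congr {S T : ℕ → 𝓜(ℂ, J)} {X : 𝓜(ℂ, J)} (h : StrictTendsto S X)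
    (hST : ∀ n, S n = T n) : StrictTendsto T X := funext hST ▸ h

theorem StrictTendsto.unique {S : ℕ → 𝓜(ℂ, J)} {X Y : 𝓜(ℂ, J)} (h : StrictTendsto S X)
    (h' : StrictTendsto S Y) : X = Y :=
  ext_coe fun j => tendsto_nhds_unique (h _ (memJ_coe j)).1 (h' _ (memJ_coe j)).1

theorem StrictTendsto.sub {S T : ℕ → 𝓜(ℂ, J)} {X Y : 𝓜(ℂ, J)} (h : StrictTendsto S X)
    (h' : StrictTendsto T Y) : StrictTendsto (fun n => S n - T n) (X - Y) := fun y hy => by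
  simp only [sub_mul, mul_sub]
  exact ⟨(h y hy).1.sub (h' y hy).1, (h y hy).2.sub (h' y hy).2⟩

theorem StrictTendsto.mul_right {S : ℕ → 𝓜(ℂ, J)} {X : 𝓜(ℂ, J)} (h : StrictTendsto S X)
    (a : 𝓜(ℂ, J)) : StrictTendsto (fun n => S n * a) (X * a) := fun y hy => by
  simp only [mul_assoc]
  refine ⟨(h _ (hy.mul_left a)).1, ?_⟩
  simp only [← mul_assoc]
  exact (h y hy).2.mul_const a

theorem StrictTendsto.mul_left {S : ℕ → 𝓜(ℂ, J)} {X : 𝓜(ℂ, J)} (h : StrictTendsto S X)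
    (a : 𝓜(ℂ, J)) : StrictTendsto (fun n => a * S n) (a * X) := fun y hy => by
  simp only [← mul_assoc]
  refine ⟨?_, (h _ (hy.mul_right a)).2⟩
  simp only [mul_assoc]
  exact (h y hy).1.const_mul a

theorem StrictTendsto.star {S : ℕ → 𝓜(ℂ, J)} {X : 𝓜(ℂ, J)} (h : StrictTendsto S X) :
    StrictTendsto (fun n => star (S n)) (star X) := fun y hy => by
  have h1 := h _ hy.star
  refine ⟨?_, ?_⟩
  · simpa using h1.2.star
  · simpa using h1.1.star

theorem StrictTendsto.extendAut {S : ℕ → 𝓜(ℂ, J)} {X : 𝓜(ℂ, J)} (h : StrictTendsto S X)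
    (α : J ≃⋆ₐ[ℂ] J) : StrictTendsto (fun n => extendAut α (S n)) (extendAut α X) := by
  rintro _ ⟨j, rfl⟩
  have hj : (j : 𝓜(ℂ, J)) = extendHom α ((α.symm j : J) : 𝓜(ℂ, J)) := by
    change _ = LoopKK.extendAut α _
    rw [extendAut_coe, StarAlgEquiv.apply_symm_apply]
  have h1 := h _ (memJ_coe (α.symm j))
  have hc : Continuous (extendHom α) :=
    (AddMonoidHomClass.isometry_of_norm (extendHom α) (norm_extendAut α)).continuous
  change Tendsto (fun n => extendHom α (S n) * (j : 𝓜(ℂ, J))) atTop (𝓝 (extendHom α X * _)) ∧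
    Tendsto (fun n => (j : 𝓜(ℂ, J)) * extendHom α (S n)) atTop (𝓝 (_ * extendHom α X))
  rw [hj]
  simp only [← map_mul]
  exact ⟨(hc.tendsto _).comp h1.1, (hc.tendsto _).comp h1.2⟩

theorem StrictTendsto.norm_le {S : ℕ → 𝓜(ℂ, J)} {X : 𝓜(ℂ, J)} (h : StrictTendsto S X) {C : ℝ}
    (hC : ∀ n, ‖S n‖ ≤ C) : ‖X‖ ≤ C := by
  have hC0 : 0 ≤ C := (norm_nonneg _).trans (hC 0)
  rw [← DoubleCentralizer.norm_fst]
  refine ContinuousLinearMap.opNorm_le_bound _ hC0 fun j => ?_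
  rw [← norm_coe, ← mul_coe, ← norm_coe j]
  exact le_of_tendsto (h _ (memJ_coe j)).1.norm (Eventually.of_forall fun n =>
    (norm_mul_le _ _).trans (mul_le_mul_of_nonneg_right (hC n) (norm_nonneg _)))

theorem StrictTendsto.nonneg_and_le_one {S : ℕ → 𝓜(ℂ, J)} {X : 𝓜(ℂ, J)} (h : StrictTendsto S X)
    (h0 : ∀ n, 0 ≤ S n) (h1 : ∀ n, ‖S n‖ ≤ 1) : 0 ≤ X ∧ 0 ≤ 1 - X := by
  have hX : IsSelfAdjoint X := by
    refine isSelfAdjoint_iff.2 (h.star.unique ?_)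
    simpa only [fun n => (IsSelfAdjoint.of_nonneg (h0 n)).star_eq] using h
  have hX1 := h.norm_le h1
  have hX2 : ‖1 - X‖ ≤ 1 := ((StrictTendsto.of_tendsto tendsto_const_nhds).sub h).norm_le
    fun n => norm_one_sub_le (h0 n) (h1 n)
  exact ⟨nonneg_of_norm_one_sub_le hX hX1 hX2,
    nonneg_of_norm_one_sub_le ((IsSelfAdjoint.one _).sub hX) hX2 (by simpa using hX1)⟩

theorem StrictTendsto.eq_tsum {Z : ℕ → 𝓜(ℂ, J)} {Y : 𝓜(ℂ, J)}
    (h : StrictTendsto (fun n => ∑ k ∈ Finset.range n, Z k) Y) (hs : Summable Z) :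
    Y = ∑' k, Z k :=
  h.unique (.of_tendsto hs.hasSum.tendsto_sum_nat)

/-- A strict limit of elements of J is in general only a multiplier. Geometric decay from some index
on makes the series converge in norm, and J is norm closed. -/
theorem StrictTendsto.memJ {Z : ℕ → 𝓜(ℂ, J)} {Y : 𝓜(ℂ, J)}
    (h : StrictTendsto (fun n => ∑ k ∈ Finset.range n, Z k) Y) (hZ : ∀ k, MemJ (Z k)) {C : ℝ}
    (p : ℕ) (hC : ∀ k ≥ p, ‖Z k‖ ≤ C * (1 / 2) ^ k) : MemJ Y := by
  have hs : Summable Z := by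
    refine .of_norm_bounded_eventually_nat (summable_geometric_two.mul_left C) ?_
    filter_upwards [eventually_ge_atTop p] with k hk
    exact hC k hk
  rw [h.eq_tsum hs]
  exact MemJ.tsum hZ hs

/-- The Weierstrass test on each open set V n. Decay is only available from the index n on, where it
is uniform on V n; this suffices as continuity is local. -/
theorem StrictTendsto.memJ_and_continuous {G : Type*} [TopologicalSpace G] {Z : ℕ → G → 𝓜(ℂ, J)}
    {Y : G → 𝓜(ℂ, J)} (h : ∀ g, StrictTendsto (fun n => ∑ k ∈ Finset.range n, Z k g) (Y g))
    (hZ : ∀ k g, MemJ (Z k g)) (hcont : ∀ k, Continuous (Z k)) {V : ℕ → Set G}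
    (hV : ∀ n, IsOpen (V n)) (hcov : ∀ g, ∃ n, g ∈ V n) {C : ℝ} (hC : ∀ k g, ‖Z k g‖ ≤ C)
    (hCV : ∀ n, ∀ k ≥ n, ∀ g ∈ V n, ‖Z k g‖ ≤ C * (1 / 2) ^ k) :
    (∀ g, MemJ (Y g)) ∧ Continuous Y := by
  refine ⟨fun g => ?_, continuous_iff_continuousAt.2 fun g => ?_⟩
  · obtain ⟨n, hn⟩ := hcov g
    exact (h g).memJ (fun k => hZ k g) n fun k hk => hCV n k hk g hn
  · obtain ⟨n, hn⟩ := hcov g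
    -- The factor 2^n pays for the terms with k < n, for which only the bound C is known.
    have hb : ∀ k, ∀ g' ∈ V n, ‖Z k g'‖ ≤ C * 2 ^ n * (1 / 2) ^ k := by
      intro k g' hg'
      have hC0 : 0 ≤ C := (norm_nonneg _).trans (hC 0 g')
      rcases le_or_gt n k with hk | hk
      · refine (hCV n k hk g' hg').trans (mul_le_mul_of_nonneg_right ?_ (by positivity))
        exact le_mul_of_one_le_right hC0 (one_le_pow₀ one_le_two)
      · refine (hC k g').trans ?_
        rw [mul_assoc, one_div, inv_pow, ← div_eq_mul_inv]
        refine le_mul_of_one_le_right hC0 ?_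
        rw [one_le_div (by positivity)]
        exact pow_le_pow_right₀ one_le_two hk.le
    have hsum := summable_geometric_two.mul_left (C * 2 ^ n)
    have h1 : ContinuousOn (fun g => ∑' k, Z k g) (V n) :=
      continuousOn_tsum (fun k => (hcont k).continuousOn) hsum hb
    refine (h1.congr fun g' hg' => ?_).continuousAt ((hV n).mem_nhds hn)
    exact (h g').eq_tsum (.of_norm_bounded hsum fun k => hb k g' hg')

end StrictLimits

/-! ### Even, quasi-central, almost invariant approximate units -/

section ApproximateUnits

attribute [local instance] CStarAlgebra.spectralOrder CStarAlgebra.spectralOrderedRing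

theorem isPos_iff_nonneg {A : Type*} [CStarAlgebra A] {a : A} : IsPos a ↔ 0 ≤ a :=
  CStarAlgebra.nonneg_iff_eq_star_mul_self.symm

theorem eventually_unit_of_isCompact {A : Type*} [CStarAlgebra A] {e : ℕ → A}
    (he : ∀ i, ‖e i‖ ≤ 1) {Y : Set A} (hY : IsCompact Y)
    (h1 : ∀ y ∈ Y, Tendsto (fun i => e i * y) atTop (𝓝 y))
    (h2 : ∀ y ∈ Y, Tendsto (fun i => y * e i) atTop (𝓝 y)) {ε : ℝ} (hε : 0 < ε) :
    ∀ᶠ i in atTop, ∀ y ∈ Y, ‖e i * y - y‖ ≤ ε ∧ ‖y * e i - y‖ ≤ ε := by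
  obtain ⟨t, htY, ht, hcov⟩ := hY.finite_cover_balls (e := ε / 3) (by positivity)
  have h : ∀ᶠ i in atTop, ∀ z ∈ t, ‖e i * z - z‖ ≤ ε / 3 ∧ ‖z * e i - z‖ ≤ ε / 3 := by
    refine (eventually_all_finite ht).2 fun z hz => ?_
    have h3 := (tendsto_iff_norm_sub_tendsto_zero.1 (h1 z (htY hz))).eventually_le_const
      (show 0 < ε / 3 by positivity)
    have h4 := (tendsto_iff_norm_sub_tendsto_zero.1 (h2 z (htY hz))).eventually_le_const
      (show 0 < ε / 3 by positivity)
    exact h3.and h4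
  filter_upwards [h] with i hi y hy
  obtain ⟨z, hz, hyz⟩ := Set.mem_iUnion₂.1 (hcov hy)
  rw [mem_ball_iff_norm] at hyz
  have hyz' : ‖z - y‖ ≤ ε / 3 := by rw [norm_sub_rev]; exact hyz.le
  have e1 : e i * y - y = e i * (y - z) + (e i * z - z) + (z - y) := by noncomm_ring
  have e2 : y * e i - y = (y - z) * e i + (z * e i - z) + (z - y) := by noncomm_ring
  rw [e1, e2]
  constructor
  · calc _ ≤ ‖e i‖ * ‖y - z‖ + ε / 3 + ε / 3 :=
          norm_add_le_of_le (norm_add_le_of_le (norm_mul_le _ _) (hi z hz).1) hyz'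
      _ ≤ 1 * (ε / 3) + ε / 3 + ε / 3 := by gcongr; exact he i
      _ = ε := by ring
  · calc _ ≤ ‖y - z‖ * ‖e i‖ + ε / 3 + ε / 3 :=
          norm_add_le_of_le (norm_add_le_of_le (norm_mul_le _ _) (hi z hz).2) hyz'
      _ ≤ ε / 3 * 1 + ε / 3 + ε / 3 := by gcongr; exact he i
      _ = ε := by ring

variable {J : Type*} [NonUnitalCStarAlgebra J] {G : Type*} [Group G] [TopologicalSpace G]
  {E : GAlgebra G J} {B : NonUnitalStarSubalgebra ℂ 𝓜(ℂ, J)} {e : ℕ → 𝓜(ℂ, J)}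

variable (E B e) in
/-- An increasing approximate unit of a subalgebra of the multiplier algebra which consists of
even positive contractions. -/
structure IsEvenApproxUnit : Prop where
  mem : ∀ i, e i ∈ B
  nonneg : ∀ i, 0 ≤ e i
  norm_le : ∀ i, ‖e i‖ ≤ 1
  mono : Monotone e
  even : ∀ i, gradHom E (e i) = e i
  tendsto_mul : ∀ y ∈ B, Tendsto (fun i => e i * y) atTop (𝓝 y)
  mul_tendsto : ∀ y ∈ B, Tendsto (fun i => y * e i) atTop (𝓝 y)

theorem continuous_gradHom : Continuous (gradHom E) :=
  (AddMonoidHomClass.isometry_of_norm (gradHom E) (norm_gradHom E)).continuous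

/-- Average an approximate unit with its image under the grading. The isometric embedding f allows
both J, through its canonical map, and a subalgebra, through its inclusion. -/
theorem exists_isEvenApproxUnit {C : Type*} [NonUnitalNormedRing C] [StarRing C] [Module ℂ C]
    (f : C →⋆ₙₐ[ℂ] 𝓜(ℂ, J)) (hf : ∀ c, ‖f c‖ = ‖c‖) (hfB : ∀ x, x ∈ B ↔ ∃ c, f c = x)
    (hC : IsSigmaUnital C) (hB : ∀ a ∈ B, mGrading E a ∈ B) : ∃ e, IsEvenApproxUnit E B e := by
  obtain ⟨u, hpos, hnorm, hmono, hlim⟩ := hC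
  have hfpos : ∀ c, IsPos c → 0 ≤ f c := by
    rintro _ ⟨b, rfl⟩
    rw [map_mul, map_star]
    exact star_mul_self_nonneg _
  have hfc : Continuous f := (AddMonoidHomClass.isometry_of_norm f hf).continuous
  have hgc := continuous_gradHom (E := E)
  have hsmul : ∀ (r : ℝ) (x : 𝓜(ℂ, J)), gradHom E (r • x) = r • gradHom E x := fun r x =>
    (gradHom E).toLinearMap.map_smul_of_tower r x
  have hfB' : ∀ c, f c ∈ B := fun c => (hfB _).2 ⟨c, rfl⟩
  have hhalf : ∀ y : 𝓜(ℂ, J), (1 / 2 : ℝ) • (y + y) = y := fun y => by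
    rw [← two_smul ℝ y, smul_smul]
    norm_num
  refine ⟨fun i => (1 / 2 : ℝ) • (f (u i) + gradHom E (f (u i))), fun i => ?_, fun i => ?_,
    fun i => ?_, monotone_nat_of_le_succ fun i => ?_, fun i => ?_, fun y hy => ?_, fun y hy => ?_⟩
  · have : ((1 / 2 : ℝ) • (f (u i) + gradHom E (f (u i))) : 𝓜(ℂ, J)) =
        (((1 / 2 : ℝ) : ℂ)) • (f (u i) + gradHom E (f (u i))) := rfl
    rw [this]
    exact SMulMemClass.smul_mem _ (add_mem (hfB' _) (hB _ (hfB' _)))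
  · exact smul_nonneg (by positivity) (add_nonneg (hfpos _ (hpos i))
      (map_nonneg _ (hfpos _ (hpos i))))
  · rw [norm_smul]
    have h1 : ‖f (u i)‖ ≤ 1 := (hf _).trans_le (hnorm i)
    have h2 : ‖f (u i) + gradHom E (f (u i))‖ ≤ 1 + 1 :=
      norm_add_le_of_le h1 ((norm_gradHom E _).trans_le h1)
    norm_num
    linarith
  · have h1 : f (u i) ≤ f (u (i + 1)) := by
      rw [← sub_nonneg, ← map_sub]
      exact hfpos _ (hmono i)
    exact smul_le_smul_of_nonneg_left (add_le_add h1 (OrderHomClass.mono _ h1)) (by positivity)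
  · rw [hsmul, map_add, gradHom_gradHom, add_comm]
  · obtain ⟨c, rfl⟩ := (hfB y).1 hy
    obtain ⟨c', hc'⟩ := (hfB _).1 (hB _ hy)
    have h1 : Tendsto (fun i => f (u i) * f c) atTop (𝓝 (f c)) := by
      simp only [← map_mul]
      exact (hfc.tendsto _).comp (hlim c).1
    have h2 : Tendsto (fun i => gradHom E (f (u i)) * f c) atTop (𝓝 (f c)) := by
      have h3 : Tendsto (fun i => f (u i) * f c') atTop (𝓝 (f c')) := by
        simp only [← map_mul]
        exact (hfc.tendsto _).comp (hlim c').1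
      rw [hc', mGrading_eq] at h3
      have h4 := (hgc.tendsto _).comp h3
      simpa only [Function.comp_def, map_mul, gradHom_gradHom] using h4
    have h5 := (h1.add h2).const_smul (1 / 2 : ℝ)
    rw [hhalf] at h5
    simpa only [smul_mul_assoc, add_mul] using h5
  · obtain ⟨c, rfl⟩ := (hfB y).1 hy
    obtain ⟨c', hc'⟩ := (hfB _).1 (hB _ hy)
    have h1 : Tendsto (fun i => f c * f (u i)) atTop (𝓝 (f c)) := by
      simp only [← map_mul]
      exact (hfc.tendsto _).comp (hlim c).2
    have h2 : Tendsto (fun i => f c * gradHom E (f (u i))) atTop (𝓝 (f c)) := by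
      have h3 : Tendsto (fun i => f c' * f (u i)) atTop (𝓝 (f c')) := by
        simp only [← map_mul]
        exact (hfc.tendsto _).comp (hlim c').2
      rw [hc', mGrading_eq] at h3
      have h4 := (hgc.tendsto _).comp h3
      simpa only [Function.comp_def, map_mul, gradHom_gradHom] using h4
    have h5 := (h1.add h2).const_smul (1 / 2 : ℝ)
    rw [hhalf] at h5
    simpa only [mul_smul_comm, mul_add] using h5

/-- Apart from monotonicity, each defining condition, with its limits written as norm bounds on
tails, describes a convex set. -/
theorem IsEvenApproxUnit.of_convexHull (he : IsEvenApproxUnit E B e) {b : ℕ → 𝓜(ℂ, J)}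
    (hb : Monotone b) (hbe : ∀ n, b n ∈ convexHull ℝ (e '' Set.Ici n)) :
    IsEvenApproxUnit E B b := by
  have key : ∀ {s : Set 𝓜(ℂ, J)} (n : ℕ), Convex ℝ s → (∀ i ≥ n, e i ∈ s) → b n ∈ s := by
    intro s n hs h
    refine convexHull_min ?_ hs (hbe n)
    rintro _ ⟨i, hi, rfl⟩
    exact h i hi
  refine ⟨fun n => key (s := B) n ?_ fun i _ => he.mem i,
    fun n => key n (convex_Ici (𝕜 := ℝ) 0) fun i _ => he.nonneg i, fun n => ?_, hb,
    fun n => key n (s := {x | gradHom E x = x}) ?_ fun i _ => he.even i,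
    fun y hy => ?_, fun y hy => ?_⟩
  · exact (B.toNonUnitalSubalgebra.toSubmodule.restrictScalars ℝ).convex
  · have := key n (convex_closedBall (0 : 𝓜(ℂ, J)) 1) fun i _ => by simpa using he.norm_le i
    simpa using this
  · exact (LinearMap.eqLocus ((gradHom E).toLinearMap.restrictScalars ℝ) LinearMap.id).convex
  · rw [Metric.tendsto_atTop']
    intro ε hε
    obtain ⟨N, hN⟩ := Metric.tendsto_atTop.1 (he.tendsto_mul y hy) (ε / 2) (by positivity)
    refine ⟨N, fun n hn => ?_⟩
    rw [dist_eq_norm]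
    refine lt_of_le_of_lt (key n (convex_norm_mul_sub_le y (ε / 2)) fun i hi => ?_)
      (half_lt_self hε)
    have := hN i (hn.le.trans hi)
    rw [dist_eq_norm] at this
    exact this.le
  · rw [Metric.tendsto_atTop']
    intro ε hε
    obtain ⟨N, hN⟩ := Metric.tendsto_atTop.1 (he.mul_tendsto y hy) (ε / 2) (by positivity)
    refine ⟨N, fun n hn => ?_⟩
    rw [dist_eq_norm]
    refine lt_of_le_of_lt (key n (convex_norm_mul_sub_le' y (ε / 2)) fun i hi => ?_)
      (half_lt_self hε)
    have := hN i (hn.le.trans hi)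
    rw [dist_eq_norm] at this
    exact this.le

/-- The commutator with `x`. -/
noncomputable def commMap (x : 𝓜(ℂ, J)) : 𝓜(ℂ, J) →ₗ[ℂ] 𝓜(ℂ, J) :=
  LinearMap.mulLeft ℂ x - LinearMap.mulRight ℂ x

variable (E) in
/-- The displacement by `g`. -/
noncomputable def actSub (g : G) : 𝓜(ℂ, J) →ₗ[ℂ] 𝓜(ℂ, J) :=
  (actHom E g).toLinearMap - LinearMap.id

theorem actSub_apply (g : G) (y : 𝓜(ℂ, J)) : actSub E g y = actHom E g y - y := rfl

/-- The commutator with `e i` lies in B, so its adjoint can play the role of y in the second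
hypothesis. -/
theorem IsEvenApproxUnit.asympOrthogonal_commMap (he : IsEvenApproxUnit E B e) {x : 𝓜(ℂ, J)}
    (hx : ∀ i, x * e i - e i * x ∈ B)
    (hx' : ∀ y ∈ B, Tendsto (fun j => y * (x * e j - e j * x)) atTop (𝓝 0)) :
    AsympOrthogonal e {commMap x} := by
  constructor
  · filter_upwards [eventually_ge_atTop (‖x‖ * 1 + 1 * ‖x‖)] with C hC T hT i
    obtain rfl := Set.mem_singleton_iff.1 hT
    refine le_trans (norm_sub_le_of_le (norm_mul_le _ _) (norm_mul_le _ _)) (le_trans ?_ hC)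
    gcongr <;> exact he.norm_le i
  · intro i δ hδ
    have h1 := tendsto_zero_iff_norm_tendsto_zero.1 (hx' _ (star_mem (hx i)))
    filter_upwards [h1.eventually_le_const hδ] with j hj T hT
    obtain rfl := Set.mem_singleton_iff.1 hT
    exact hj

/-- Norm continuity makes the displacements of a fixed `e i` by g ∈ K a compact subset of B, on
which the approximate unit acts uniformly. -/
theorem IsEvenApproxUnit.asympOrthogonal_actSub [IsTopologicalGroup G]
    (hB : IsGSubalgebra E B) (he : IsEvenApproxUnit E B e) {K : Set G} (hK : IsCompact K) :
    AsympOrthogonal e (actSub E '' K) := by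
  constructor
  · filter_upwards [eventually_ge_atTop 2] with C hC T hT i
    obtain ⟨g, -, rfl⟩ := hT
    refine le_trans (norm_sub_le_of_le ((norm_actHom E g _).trans_le (he.norm_le i))
      (he.norm_le i)) (le_trans ?_ hC)
    norm_num
  · intro i δ hδ
    have hc : Continuous fun g => actHom E g (e i) := hB.2.2 _ (he.mem i)
    have hmem : ∀ g, actHom E g (e i) ∈ B := fun g => hB.2.1 g _ (he.mem i)
    have hY1 := hK.image (hc.sub (continuous_const (y := e i)))
    have hY2 := hK.image ((continuous_const (y := e i)).sub (hc.comp continuous_inv))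
    have hm1 : ∀ y ∈ (fun g => actHom E g (e i) - e i) '' K, y ∈ B := by
      rintro _ ⟨g, -, rfl⟩
      exact sub_mem (hmem g) (he.mem i)
    have hm2 : ∀ y ∈ (fun g => e i - actHom E g⁻¹ (e i)) '' K, y ∈ B := by
      rintro _ ⟨g, -, rfl⟩
      exact sub_mem (he.mem i) (hmem g⁻¹)
    filter_upwards [eventually_unit_of_isCompact he.norm_le hY1
        (fun y hy => he.tendsto_mul y (hm1 y hy)) (fun y hy => he.mul_tendsto y (hm1 y hy))
        (half_pos hδ),
      eventually_unit_of_isCompact he.norm_le hY2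
        (fun y hy => he.tendsto_mul y (hm2 y hy)) (fun y hy => he.mul_tendsto y (hm2 y hy))
        (half_pos hδ)] with j h1 h2 T hT
    obtain ⟨g, hg, rfl⟩ := hT
    have h1' := (h1 _ ⟨g, hg, rfl⟩).2
    have h2' := (h2 _ ⟨g, hg, rfl⟩).2
    have hsa : star (e i) = e i := (IsSelfAdjoint.of_nonneg (he.nonneg i)).star_eq
    rw [actSub_apply, actSub_apply, star_sub, ← map_star, hsa]
    set y := actHom E g (e i) - e i
    -- Pulling g out of y · g(e_j) leaves e_j acting on e_i - g⁻¹(e_i). Both right-hand terms thus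
    -- measure how well e_j fixes an element of a compact set.
    have e1 : y * (actHom E g (e j) - e j) =
        actHom E g ((e i - actHom E g⁻¹ (e i)) * e j - (e i - actHom E g⁻¹ (e i))) -
          (y * e j - y) := by
      have hy : y = actHom E g (e i) - e i := rfl
      rw [map_sub, map_mul, map_sub, actHom_actHom_inv, hy]
      noncomm_ring
    rw [e1]
    calc _ ≤ δ / 2 + δ / 2 := norm_sub_le_of_le ((norm_actHom E g _).trans_le h2') h1'
      _ = δ := add_halves δ

/-- Quasi-central, almost invariant approximate units. -/
theorem IsEvenApproxUnit.exists_quasicentral [IsTopologicalGroup G] (hB : IsGSubalgebra E B)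
    (he : IsEvenApproxUnit E B e) {F : ℕ → Set 𝓜(ℂ, J)} (hF : ∀ k, (F k).Finite)
    (hFB : ∀ k, ∀ x ∈ F k, ∀ i, x * e i - e i * x ∈ B)
    (hF0 : ∀ k, ∀ x ∈ F k, ∀ y ∈ B, Tendsto (fun j => y * (x * e j - e j * x)) atTop (𝓝 0))
    {K : ℕ → Set G} (hK : ∀ k, IsCompact (K k)) {Y : ℕ → Set 𝓜(ℂ, J)}
    (hY : ∀ k, IsCompact (Y k)) (hYB : ∀ k, ∀ y ∈ Y k, y ∈ B) {η : ℕ → ℝ} (hη : ∀ k, 0 < η k) :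
    ∃ b, IsEvenApproxUnit E B b ∧ ∀ n, ∀ k ≤ n, (∀ x ∈ F k, ‖x * b n - b n * x‖ ≤ η k) ∧
      (∀ g ∈ K k, ‖actHom E g (b n) - b n‖ ≤ η k) ∧
      ∀ y ∈ Y k, ‖b n * y - y‖ ≤ η k ∧ ‖y * b n - y‖ ≤ η k := by
  obtain ⟨b, hmono, hb⟩ := exists_monotone_seq he.mono
    (𝒯 := fun k => (⋃ x ∈ F k, {commMap x}) ∪ actSub E '' K k)
    (fun k => (AsympOrthogonal.biUnion (hF k) fun x hx =>
      he.asympOrthogonal_commMap (hFB k x hx) (hF0 k x hx)).union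
        (he.asympOrthogonal_actSub hB (hK k)))
    (Y := Y) (fun k ε hε => eventually_unit_of_isCompact he.norm_le (hY k)
      (fun y hy => he.tendsto_mul y (hYB k y hy)) (fun y hy => he.mul_tendsto y (hYB k y hy)) hε) hη
  refine ⟨b, he.of_convexHull hmono fun n => (hb n).1, fun n k hk => ⟨fun x hx => ?_,
    fun g hg => ?_, ((hb n).2 k hk).2⟩⟩
  · exact ((hb n).2 k hk).1 (commMap x) (Or.inl (Set.mem_biUnion hx rfl))
  · exact ((hb n).2 k hk).1 (actSub E g) (Or.inr ⟨g, hg, rfl⟩)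

end ApproximateUnits

/-! ### Derivations, blocks and their strict sums -/

section TechnicalTheorem

attribute [local instance] CStarAlgebra.spectralOrder CStarAlgebra.spectralOrderedRing

variable {J : Type*} [NonUnitalCStarAlgebra J] {G : Type*} [Group G] [TopologicalSpace G]
  {E : GAlgebra G J} {B : NonUnitalStarSubalgebra ℂ 𝓜(ℂ, J)} {e : ℕ → 𝓜(ℂ, J)}

/-- Both y and yx lie in the ideal J, so y x e_j and y e_j x have the same limit yx. Hence J admits
units quasi-central for any multiplier. -/
theorem IsEvenApproxUnit.mul_comm_tendsto_of_ideal (he : IsEvenApproxUnit E (ideal J) e)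
    (x : 𝓜(ℂ, J)) {y : 𝓜(ℂ, J)} (hy : y ∈ ideal J) :
    Tendsto (fun j => y * (x * e j - e j * x)) atTop (𝓝 0) := by
  have h1 := he.mul_tendsto (y * x) (MemJ.mul_right hy x)
  have h2 := (he.mul_tendsto y hy).mul_const x
  have h3 := h1.sub h2
  rw [sub_self] at h3
  simpa only [mul_sub, mul_assoc] using h3

theorem gradHom_evenPart (x : 𝓜(ℂ, J)) : gradHom E (evenPart E x) = evenPart E x := by
  rw [evenPart, map_smul, map_add, mGrading_eq, gradHom_gradHom, add_comm]

theorem gradHom_oddPart (x : 𝓜(ℂ, J)) : gradHom E (oddPart E x) = -oddPart E x := by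
  rw [oddPart, map_smul, map_sub, mGrading_eq, gradHom_gradHom, ← smul_neg, neg_sub]

/-- If `d` derives `B`, then so do its even and its odd part. -/
theorem mem_of_derives (hB : ∀ a ∈ B, mGrading E a ∈ B) {d : 𝓜(ℂ, J)}
    (hd : ∀ a ∈ B, gradedComm E d a ∈ B) {a : 𝓜(ℂ, J)} (ha : a ∈ B) :
    evenPart E d * a - a * evenPart E d ∈ B ∧
      oddPart E d * a - gradHom E a * oddPart E d ∈ B := by
  have h1 := hd a ha
  -- Conjugating the derivation by the grading reverses the sign of the odd part of d. Half the sum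
  -- and half the difference of the two memberships isolate the parts.
  have h2 := hB _ (hd _ (hB _ ha))
  rw [gradedComm_eq] at h1
  rw [mGrading_eq, mGrading_eq, gradedComm_eq] at h2
  simp only [map_sub, map_add, map_mul, gradHom_gradHom, gradHom_evenPart, gradHom_oddPart] at h2
  have h3 := evenPart_add_oddPart E d
  have h4 : gradHom E d = evenPart E d - oddPart E d := by
    nth_rw 1 [← h3]
    rw [map_add, gradHom_evenPart, gradHom_oddPart, sub_eq_add_neg]
  rw [h4] at h2
  set p := evenPart E d
  set q := oddPart E d
  rw [← h3] at h1
  set c := gradHom E a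
  have hhalf : ∀ x : 𝓜(ℂ, J), x + x ∈ B → x ∈ B := by
    intro x hx
    have := SMulMemClass.smul_mem (1 / 2 : ℂ) hx
    rw [← two_smul ℂ x, smul_smul] at this
    norm_num at this
    exact this
  constructor
  · refine hhalf _ ?_
    have e1 : p * a - a * p + (p * a - a * p) =
        ((p + q) * a - (a * p + c * q)) + ((p - q) * a - (a * p + c * -q)) := by noncomm_ring
    have e2 := add_mem h1 h2
    rwa [← e1] at e2
  · refine hhalf _ ?_
    have e1 : q * a - c * q + (q * a - c * q) =
        ((p + q) * a - (a * p + c * q)) - ((p - q) * a - (a * p + c * -q)) := by noncomm_ring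
    have e2 := sub_mem h1 h2
    rwa [← e1] at e2

theorem IsEvenApproxUnit.comm_mem_of_derives (he : IsEvenApproxUnit E B e) {d : 𝓜(ℂ, J)}
    (hd : ∀ a ∈ B, gradedComm E d a ∈ B) (i : ℕ) : d * e i - e i * d ∈ B := by
  have h := hd _ (he.mem i)
  rwa [gradedComm_eq, he.even, ← mul_add, evenPart_add_oddPart] at h

/-- Here yd need not lie in B, but the even part p satisfies y p e_j = p y e_j - (py - yp) e_j with
py - yp ∈ B, and the right side tends to yp. For the odd part, the y after the moved factor is
replaced by its image under the grading. -/
theorem IsEvenApproxUnit.mul_comm_tendsto_of_derives (hB : ∀ a ∈ B, mGrading E a ∈ B)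
    (he : IsEvenApproxUnit E B e) {d : 𝓜(ℂ, J)} (hd : ∀ a ∈ B, gradedComm E d a ∈ B)
    {y : 𝓜(ℂ, J)} (hy : y ∈ B) :
    Tendsto (fun j => y * (d * e j - e j * d)) atTop (𝓝 0) := by
  set p := evenPart E d with hp
  set q := oddPart E d with hq
  have h1 : Tendsto (fun j => y * (p * e j - e j * p)) atTop (𝓝 0) := by
    have h2 := he.mul_tendsto _ (mem_of_derives hB hd hy).1
    have h3 := ((he.mul_tendsto y hy).const_mul p).sub ((he.mul_tendsto y hy).mul_const p)
    have h4 := h3.sub h2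
    rw [sub_self] at h4
    refine h4.congr fun j => ?_
    rw [← hp]
    noncomm_ring
  have h2 : Tendsto (fun j => y * (q * e j - e j * q)) atTop (𝓝 0) := by
    have hz : gradHom E y ∈ B := hB y hy
    have h2 := he.mul_tendsto _ (mem_of_derives hB hd hz).2
    have h3 := ((he.mul_tendsto _ hz).const_mul q).sub ((he.mul_tendsto y hy).mul_const q)
    rw [gradHom_gradHom] at h2
    have h4 := h3.sub h2
    rw [sub_self] at h4
    refine h4.congr fun j => ?_
    rw [← hq]
    noncomm_ring
  have h3 := h1.add h2
  rw [add_zero] at h3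
  refine h3.congr fun j => ?_
  have h4 : p + q = d := evenPart_add_oddPart E d
  rw [← h4]
  noncomm_ring

/-- For s = √D, the C*-identity bounds ‖s e_n - s‖² by 2‖D e_n - D‖. So s is a limit of elements s
e_n of the closed ideal J. -/
theorem IsEvenApproxUnit.memJ_sqrt (he : IsEvenApproxUnit E (ideal J) e) {D : 𝓜(ℂ, J)}
    (hD : MemJ D) (hD0 : 0 ≤ D) : MemJ (CFC.sqrt D) := by
  set s := CFC.sqrt D with hs
  have hss : s * s = D := CFC.sqrt_mul_sqrt_self D hD0
  have hsa : star s = s := (IsSelfAdjoint.of_nonneg (CFC.sqrt_nonneg D)).star_eq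
  have h1 : Tendsto (fun n => D * e n - D) atTop (𝓝 0) := by
    simpa using (he.mul_tendsto D hD).sub_const D
  have h2 : ∀ n, ‖s * e n - s‖ ^ 2 ≤ 2 * ‖D * e n - D‖ := by
    intro n
    have hen : star (e n) = e n := (IsSelfAdjoint.of_nonneg (he.nonneg n)).star_eq
    rw [sq, ← CStarRing.norm_star_mul_self, star_sub, star_mul, hsa, hen]
    have e1 : (e n * s - s) * (s * e n - s) = e n * (D * e n - D) - (D * e n - D) := by
      rw [← hss]
      noncomm_ring
    rw [e1]
    calc _ ≤ ‖e n‖ * ‖D * e n - D‖ + ‖D * e n - D‖ := norm_sub_le_of_le (norm_mul_le _ _) le_rfl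
      _ ≤ 1 * ‖D * e n - D‖ + ‖D * e n - D‖ := by gcongr; exact he.norm_le n
      _ = _ := by ring
  have h3 : Tendsto (fun n => ‖s * e n - s‖ ^ 2) atTop (𝓝 0) :=
    squeeze_zero (fun _ => by positivity) h2 (by simpa using h1.norm.const_mul 2)
  have h4 : Tendsto (fun n => s * e n) atTop (𝓝 s) := by
    rw [tendsto_iff_norm_sub_tendsto_zero]
    have := h3.sqrt
    simpa using this
  exact isClosed_memJ.mem_of_tendsto h4 (Eventually.of_forall fun n => MemJ.mul_left (he.mem n) s)

/-- Take X = √D u √D: unlike Du it is positive and below D, and it is close to Du once D almost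
commutes with u. That δ is independent of D and u lets it be fixed before the approximate unit is
chosen. -/
theorem IsEvenApproxUnit.exists_block (he : IsEvenApproxUnit E (ideal J) e) {ε : ℝ} (hε : 0 < ε) :
    ∃ δ > 0, ∀ D u : 𝓜(ℂ, J), MemJ D → 0 ≤ D → ‖D‖ ≤ 1 → gradHom E D = D → 0 ≤ u → ‖u‖ ≤ 1 →
      gradHom E u = u → ‖D * u - u * D‖ ≤ δ →
      ∃ X, MemJ X ∧ 0 ≤ X ∧ X ≤ D ∧ gradHom E X = X ∧ ‖X - D * u‖ ≤ ε := by
  obtain ⟨δ, hδ, h⟩ := exists_norm_commutator_sqrt_le (A := 𝓜(ℂ, J)) hε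
  refine ⟨δ, hδ, fun D u hD hD0 hD1 hDg hu0 hu1 hug hDu => ?_⟩
  have hJ := he.memJ_sqrt hD hD0
  have hc := h D u hD0 hD1 hu1 hDu
  have hg : CFC.sqrt D = gradHom E (CFC.sqrt D) :=
    CFC.sqrt_unique (by rw [← map_mul, CFC.sqrt_mul_sqrt_self D hD0, hDg])
      (map_nonneg _ (CFC.sqrt_nonneg D))
  have hss : CFC.sqrt D * CFC.sqrt D = D := CFC.sqrt_mul_sqrt_self D hD0
  have hsa : star (CFC.sqrt D) = CFC.sqrt D :=
    (IsSelfAdjoint.of_nonneg (CFC.sqrt_nonneg D)).star_eq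
  have hs1 : ‖CFC.sqrt D‖ ≤ 1 := by
    refine le_of_sq_le_sq ?_ zero_le_one
    rw [sq, ← CStarRing.norm_star_mul_self, hsa, hss]
    simpa using hD1
  set s := CFC.sqrt D
  refine ⟨s * u * s, hJ.mul_left _, ?_, ?_, by rw [map_mul, map_mul, ← hg, hug], ?_⟩
  · have := star_left_conjugate_nonneg hu0 s
    rwa [hsa] at this
  · have := star_left_conjugate_le_conjugate
      ((CStarAlgebra.norm_le_one_iff_of_nonneg u hu0).1 hu1) s
    rwa [hsa, mul_one, hss] at this
  · have e1 : s * u * s - D * u = -(s * (s * u - u * s)) := by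
      rw [← hss]
      noncomm_ring
    rw [e1, norm_neg]
    calc _ ≤ ‖s‖ * ‖s * u - u * s‖ := norm_mul_le _ _
      _ ≤ 1 * ε := by gcongr
      _ = ε := one_mul ε

/-- Differences of partial sums are positive and dominated by b_q - b_p, which tends to 0 strictly.
The other side follows by taking adjoints. -/
theorem IsEvenApproxUnit.exists_strict_sum {b : ℕ → 𝓜(ℂ, J)}
    (hb : IsEvenApproxUnit E (ideal J) b) {X : ℕ → 𝓜(ℂ, J)} (h0 : ∀ k, 0 ≤ X k)
    (hX : ∀ k, X k ≤ b (k + 1) - b k) :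
    ∃ M, StrictTendsto (fun n => ∑ k ∈ Finset.range n, X k) M ∧ 0 ≤ M ∧ 0 ≤ 1 - M := by
  set S : ℕ → 𝓜(ℂ, J) := fun n => ∑ k ∈ Finset.range n, X k with hS
  have hS0 : ∀ {p q : ℕ}, p ≤ q → 0 ≤ S q - S p ∧ S q - S p ≤ b q - b p := by
    intro p q hpq
    rw [hS, ← Finset.sum_Ico_eq_sub X hpq, ← Finset.sum_Ico_sub b hpq]
    exact ⟨Finset.sum_nonneg fun k _ => h0 k, Finset.sum_le_sum fun k _ => hX k⟩
  have hSn : ∀ {p q : ℕ}, p ≤ q → ‖S q - S p‖ ≤ 1 := by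
    intro p q hpq
    refine (CStarAlgebra.norm_le_norm_of_nonneg_of_le (hS0 hpq).1 ?_).trans (hb.norm_le q)
    exact (hS0 hpq).2.trans (sub_le_self _ (hb.nonneg p))
  have hcauchy : ∀ y : 𝓜(ℂ, J), MemJ y → CauchySeq fun n => S n * y := by
    intro y hy
    rw [Metric.cauchySeq_iff']
    intro ε hε
    obtain ⟨N, hN⟩ := Metric.cauchySeq_iff'.1 (hb.tendsto_mul y hy).cauchySeq
      (ε ^ 2 / (‖y‖ + 1)) (by positivity)
    refine ⟨N, fun n hn => ?_⟩
    have h1 := hN n hn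
    rw [dist_eq_norm, ← sub_mul] at h1 ⊢
    have h2 := norm_mul_sq_le_of_le (hS0 hn).1 (hS0 hn).2 (hSn hn) y
    refine lt_of_pow_lt_pow_left₀ 2 hε.le (h2.trans_lt ?_)
    rw [lt_div_iff₀ (by positivity)] at h1
    calc _ ≤ ‖y‖ * ‖(b n - b N) * y‖ := by
          rw [mul_assoc]
          exact (norm_mul_le _ _).trans_eq (by rw [norm_star])
      _ ≤ ‖(b n - b N) * y‖ * (‖y‖ + 1) := by nlinarith [norm_nonneg ((b n - b N) * y)]
      _ < ε ^ 2 := h1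
  have hSsa : ∀ n, star (S n) = S n := fun n => by
    have := (hS0 (Nat.zero_le n)).1
    simp only [hS, Finset.range_zero, Finset.sum_empty, sub_zero] at this
    exact (IsSelfAdjoint.of_nonneg this).star_eq
  obtain ⟨M, hM⟩ := exists_strictTendsto (S := S) fun y hy => by
    refine ⟨hcauchy y hy, ?_⟩
    obtain ⟨l, hl⟩ := cauchySeq_tendsto_of_complete (hcauchy (star y) hy.star)
    refine Tendsto.cauchySeq (x := star l) (hl.star.congr fun n => ?_)
    rw [star_mul, star_star, hSsa]
  have hSz : S 0 = 0 := by simp [hS]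
  exact ⟨M, hM, hM.nonneg_and_le_one
    (fun n => by simpa [hSz] using (hS0 (Nat.zero_le n)).1)
    (fun n => by simpa [hSz] using hSn (Nat.zero_le n))⟩

end TechnicalTheorem

/-! ### Construction of the partition of unity -/

section Partition

attribute [local instance] CStarAlgebra.spectralOrder CStarAlgebra.spectralOrderedRing

variable {J : Type*} [NonUnitalCStarAlgebra J] {G : Type*} [Group G] [TopologicalSpace G]

/-- The increments of a quasi-central approximate unit of `J` together with positive blocks `X k`
below them, which are approximately the products with the elements `u k`. -/
theorem exists_blocks [IsTopologicalGroup G] (E : GAlgebra G J) (hJ : IsSigmaUnital J)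
    {F : ℕ → Set 𝓜(ℂ, J)} (hF : ∀ k, (F k).Finite) {K : ℕ → Set G} (hK : ∀ k, IsCompact (K k))
    {Y : ℕ → Set 𝓜(ℂ, J)} (hY : ∀ k, IsCompact (Y k)) (hYJ : ∀ k, ∀ y ∈ Y k, MemJ y)
    {u : ℕ → 𝓜(ℂ, J)} (hu0 : ∀ k, 0 ≤ u k) (hu1 : ∀ k, ‖u k‖ ≤ 1)
    (hue : ∀ k, gradHom E (u k) = u k) {ε : ℕ → ℝ} (hε : ∀ k, 0 < ε k) :
    ∃ b X : ℕ → 𝓜(ℂ, J), IsEvenApproxUnit E (ideal J) b ∧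
      (∀ k, MemJ (X k) ∧ 0 ≤ X k ∧ X k ≤ b (k + 1) - b k ∧ gradHom E (X k) = X k ∧
        ‖X k - (b (k + 1) - b k) * u k‖ ≤ ε k) ∧
      ∀ k, (∀ x ∈ F k, ‖x * (b (k + 1) - b k) - (b (k + 1) - b k) * x‖ ≤ 2 * ε k) ∧
        (∀ g ∈ K k, ‖actHom E g (b (k + 1) - b k) - (b (k + 1) - b k)‖ ≤ 2 * ε k) ∧
        ∀ y ∈ Y k, ‖(b (k + 1) - b k) * y‖ ≤ 2 * ε k ∧ ‖y * (b (k + 1) - b k)‖ ≤ 2 * ε k := by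
  obtain ⟨e, he⟩ := exists_isEvenApproxUnit (E := E) (B := ideal J)
    (DoubleCentralizer.coeHom (𝕜 := ℂ) (A := J)) norm_coe (fun _ => Iff.rfl) hJ
    (isGSubalgebra_ideal E).1
  choose δ hδ hblock using fun k => he.exists_block (hε k)
  set η : ℕ → ℝ := fun k => min (δ k / 2) (ε k)
  have hη : ∀ k, 0 < η k := fun k => lt_min (half_pos (hδ k)) (hε k)
  obtain ⟨b, hb, hq⟩ := he.exists_quasicentral (isGSubalgebra_ideal E)
    (F := fun k => insert (u k) (F k)) (fun k => (hF k).insert _)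
    (fun k x _ i => (MemJ.mul_left (he.mem i) x).sub (MemJ.mul_right (he.mem i) x))
    (fun k x _ y hy => he.mul_comm_tendsto_of_ideal x hy) hK hY hYJ hη
  -- An increment involves b k and b (k + 1), both of which satisfy the k-th estimates; hence the
  -- factor 2 here and below.
  have hx : ∀ k, ∀ x ∈ insert (u k) (F k),
      ‖x * (b (k + 1) - b k) - (b (k + 1) - b k) * x‖ ≤ 2 * η k := by
    intro k x hx
    have e1 : x * (b (k + 1) - b k) - (b (k + 1) - b k) * x =
        (x * b (k + 1) - b (k + 1) * x) - (x * b k - b k * x) := by noncomm_ring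
    rw [e1, two_mul]
    exact norm_sub_le_of_le ((hq (k + 1) k k.le_succ).1 x hx) ((hq k k le_rfl).1 x hx)
  have hηε : ∀ k, 2 * η k ≤ 2 * ε k := fun k => by
    have : η k ≤ ε k := min_le_right _ _
    linarith
  have hηδ : ∀ k, 2 * η k ≤ δ k := fun k => by
    have : η k ≤ δ k / 2 := min_le_left _ _
    linarith
  have hD : ∀ k, 0 ≤ b (k + 1) - b k := fun k => sub_nonneg.2 (hb.mono k.le_succ)
  choose X hX using fun k => hblock k (b (k + 1) - b k) (u k)
    (MemJ.sub (hb.mem _) (hb.mem _)) (hD k)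
    ((CStarAlgebra.norm_le_norm_of_nonneg_of_le (hD k) (sub_le_self _ (hb.nonneg k))).trans
      (hb.norm_le _)) (by rw [map_sub, hb.even, hb.even]) (hu0 k) (hu1 k) (hue k) (by
        rw [norm_sub_rev]
        exact (hx k (u k) (Set.mem_insert _ _)).trans (hηδ k))
  refine ⟨b, X, hb, hX, fun k => ⟨fun x hxF => (hx k x (Set.mem_insert_of_mem _ hxF)).trans
    (hηε k), fun g hg => ?_, fun y hy => ⟨?_, ?_⟩⟩⟩
  · have e1 : actHom E g (b (k + 1) - b k) - (b (k + 1) - b k) =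
        (actHom E g (b (k + 1)) - b (k + 1)) - (actHom E g (b k) - b k) := by
      rw [map_sub]
      abel
    rw [e1]
    refine le_trans ?_ (hηε k)
    rw [two_mul]
    exact norm_sub_le_of_le ((hq (k + 1) k k.le_succ).2.1 g hg) ((hq k k le_rfl).2.1 g hg)
  · have e1 : (b (k + 1) - b k) * y = (b (k + 1) * y - y) - (b k * y - y) := by noncomm_ring
    rw [e1]
    refine le_trans ?_ (hηε k)
    rw [two_mul]
    exact norm_sub_le_of_le ((hq (k + 1) k k.le_succ).2.2 y hy).1 ((hq k k le_rfl).2.2 y hy).1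
  · have e1 : y * (b (k + 1) - b k) = (y * b (k + 1) - y) - (y * b k - y) := by noncomm_ring
    rw [e1]
    refine le_trans ?_ (hηε k)
    rw [two_mul]
    exact norm_sub_le_of_le ((hq (k + 1) k k.le_succ).2.2 y hy).2 ((hq k k le_rfl).2.2 y hy).2

/-- A bound for a product with a block, from a bound for the product with the approximation. -/
theorem norm_block_mul_le {A : Type*} [CStarAlgebra A] {X D u a : A} {ε c C : ℝ}
    (hX : ‖X - D * u‖ ≤ ε) (h : ‖D * (u * a)‖ ≤ c) (ha : ‖a‖ ≤ C) :
    ‖X * a‖ ≤ c + C * ε := by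
  have e1 : X * a = D * (u * a) + (X - D * u) * a := by noncomm_ring
  rw [e1]
  refine norm_add_le_of_le h ((norm_mul_le _ _).trans ?_)
  rw [mul_comm]
  exact mul_le_mul ha hX (norm_nonneg _) ((norm_nonneg _).trans ha)

/-- With a on the left, u first has to be moved past D, at the cost c'. -/
theorem norm_mul_block_le {A : Type*} [CStarAlgebra A] {X D u a : A} {ε c c' C : ℝ}
    (hX : ‖X - D * u‖ ≤ ε) (hc : ‖u * D - D * u‖ ≤ c') (h : ‖a * u * D‖ ≤ c) (ha : ‖a‖ ≤ C) :
    ‖a * X‖ ≤ c + C * (ε + c') := by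
  have e1 : a * X = a * u * D + a * ((X - D * u) - (u * D - D * u)) := by noncomm_ring
  rw [e1]
  refine norm_add_le_of_le h ((norm_mul_le _ _).trans ?_)
  exact mul_le_mul ha (norm_sub_le_of_le hX hc) (norm_nonneg _) ((norm_nonneg _).trans ha)

theorem exists_dense_seq_derives {E : GAlgebra G J} {A₁ : NonUnitalStarSubalgebra ℂ 𝓜(ℂ, J)}
    {Δ : Set 𝓜(ℂ, J)} (hΔ : TopologicalSpace.IsSeparable Δ)
    (hd : ∀ d ∈ Δ, ∀ b ∈ A₁, gradedComm E d b ∈ A₁) :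
    ∃ d : ℕ → 𝓜(ℂ, J), (∀ k, ∀ b ∈ A₁, gradedComm E (d k) b ∈ A₁) ∧
      Δ ⊆ closure (Set.range d) := by
  obtain ⟨c, hcΔ, hc, hcd⟩ := hΔ.exists_countable_dense_subset
  -- Adjoining 0, which derives everything, provides a sequence even if Δ is empty.
  obtain ⟨d, hd'⟩ := (hc.insert (0 : 𝓜(ℂ, J))).exists_eq_range (Set.insert_nonempty _ _)
  refine ⟨d, fun k b hb => ?_, hcd.trans (closure_mono ?_)⟩
  · have h1 : d k ∈ insert 0 c := hd' ▸ Set.mem_range_self k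
    rcases h1 with h1 | h1
    · rw [h1, gradedComm_of_even E (map_zero (gradHom E)), zero_mul, mul_zero, sub_zero]
      exact zero_mem A₁
    · exact hd _ (hcΔ h1) b hb
  · rw [← hd']
    exact Set.subset_insert _ _

/-- Quasi-central approximate units of an algebra which is derived by a sequence. -/
theorem exists_quasicentral_of_derives [IsTopologicalGroup G] (E : GAlgebra G J)
    {A₁ : NonUnitalStarSubalgebra ℂ 𝓜(ℂ, J)} (hA₁ : IsSigmaUnital A₁)
    (hA₁G : IsGSubalgebra E A₁) {d : ℕ → 𝓜(ℂ, J)}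
    (hd : ∀ k, ∀ b ∈ A₁, gradedComm E (d k) b ∈ A₁) {K : ℕ → Set G} (hK : ∀ k, IsCompact (K k))
    {ε : ℕ → ℝ} (hε : ∀ k, 0 < ε k) :
    ∃ e u : ℕ → 𝓜(ℂ, J), IsEvenApproxUnit E A₁ e ∧ IsEvenApproxUnit E A₁ u ∧
      ∀ k, (∀ l ≤ k, ‖d l * u k - u k * d l‖ ≤ ε k) ∧
        (∀ g ∈ K k, ‖actHom E g (u k) - u k‖ ≤ ε k) ∧ ∀ l ≤ k, ‖u k * e l - e l‖ ≤ ε k := by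
  obtain ⟨e, he⟩ := exists_isEvenApproxUnit (E := E) (B := A₁)
    (NonUnitalStarSubalgebraClass.subtype A₁) (fun _ => rfl)
    (fun x => ⟨fun h => ⟨⟨x, h⟩, rfl⟩, by rintro ⟨c, rfl⟩; exact c.2⟩) hA₁ hA₁G.1
  have hfin : ∀ k : ℕ, (Set.Iic k).Finite := fun k => Set.finite_Iic k
  obtain ⟨u, hu, hq⟩ := he.exists_quasicentral hA₁G (F := fun k => d '' Set.Iic k)
    (fun k => (hfin k).image d)
    (by rintro k _ ⟨l, -, rfl⟩ i; exact he.comm_mem_of_derives (hd l) i)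
    (by rintro k _ ⟨l, -, rfl⟩ y hy; exact he.mul_comm_tendsto_of_derives hA₁G.1 (hd l) hy)
    hK (Y := fun k => e '' Set.Iic k) (fun k => ((hfin k).image e).isCompact)
    (by rintro k _ ⟨l, -, rfl⟩; exact he.mem l) hε
  exact ⟨e, u, he, hu, fun k => ⟨fun l hl => (hq k k le_rfl).1 _ ⟨l, hl, rfl⟩,
    (hq k k le_rfl).2.1, fun l hl => ((hq k k le_rfl).2.2 _ ⟨l, hl, rfl⟩).1⟩⟩

/-- The technical theorem for a group whose image in a group that acts continuously is exhausted by
compact sets. -/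
theorem exists_partition [IsTopologicalGroup G] {H : Type*} [TopologicalSpace H]
    {ι : H → G} (hι : Continuous ι) {K : ℕ → Set G} (hK : ∀ n, IsCompact (K n))
    (hKmono : Monotone K) {V : ℕ → Set H} (hV : ∀ n, IsOpen (V n)) (hVcov : ∀ g, ∃ n, g ∈ V n)
    (hVK : ∀ n, ∀ g ∈ V n, ι g ∈ K n)
    (E : GAlgebra G J) (hJ : IsSigmaUnital J)
    (A₁ A₂ : NonUnitalStarSubalgebra ℂ 𝓜(ℂ, J))
    (hA₁ : IsSigmaUnital A₁) (hA₂ : IsSigmaUnital A₂) (hA₁G : IsGSubalgebra E A₁)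
    (Δ : Set 𝓜(ℂ, J)) (hΔ : TopologicalSpace.IsSeparable Δ)
    (hΔ_derives : ∀ d ∈ Δ, ∀ b ∈ A₁, gradedComm E d b ∈ A₁)
    (φ : G → 𝓜(ℂ, J)) (hφ_bdd : ∃ C : ℝ, ∀ g, ‖φ g‖ ≤ C)
    (hA₁A₂ : ∀ a ∈ A₁, ∀ b ∈ A₂, MemJ (a * b))
    (hA₁φ : ∀ a ∈ A₁, ∀ g, MemJ (a * φ g))
    (hφA₁ : ∀ a ∈ A₁, ∀ g, MemJ (φ g * a))
    (hφ_cont : ∀ a ∈ A₁, ∀ j : J,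
      Continuous (fun g => (a + (j : 𝓜(ℂ, J))) * φ g) ∧
      Continuous (fun g => φ g * (a + (j : 𝓜(ℂ, J))))) :
    ∃ M : 𝓜(ℂ, J), 0 ≤ M ∧ 0 ≤ 1 - M ∧ gradHom E M = M ∧
      (∀ a ∈ A₁, MemJ ((1 - M) * a)) ∧ (∀ a ∈ A₂, MemJ (M * a)) ∧
      (∀ d ∈ Δ, MemJ (M * d - d * M)) ∧
      (∀ g, MemJ (M * φ (ι g)) ∧ MemJ (φ (ι g) * M)) ∧
      (∀ g, MemJ (actHom E (ι g) M - M)) ∧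
      Continuous (fun g => actHom E (ι g) M) ∧
      Continuous (fun g => M * φ (ι g)) ∧ Continuous (fun g => φ (ι g) * M) := by
  set ε : ℕ → ℝ := fun k => (1 / 2) ^ k with hεdef
  have hε : ∀ k, 0 < ε k := fun k => by positivity
  obtain ⟨C, hC⟩ := hφ_bdd
  have hC0 : 0 ≤ C := (norm_nonneg _).trans (hC 1)
  obtain ⟨d, hd, hdΔ⟩ := exists_dense_seq_derives hΔ hΔ_derives
  obtain ⟨e, u, he, hu, huq⟩ := exists_quasicentral_of_derives E hA₁ hA₁G hd hK hε
  obtain ⟨v, -, hv1, -, hv⟩ := hA₂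
  have hφl : ∀ x : 𝓜(ℂ, J), x ∈ A₁ → Continuous fun g => x * φ g := fun x hx => by
    have := (hφ_cont x hx 0).1
    rwa [show (((0 : J)) : 𝓜(ℂ, J)) = 0 from map_zero (DoubleCentralizer.coeHom (𝕜 := ℂ)),
      add_zero] at this
  have hφr : ∀ x : 𝓜(ℂ, J), x ∈ A₁ → Continuous fun g => φ g * x := fun x hx => by
    have := (hφ_cont x hx 0).2
    rwa [show (((0 : J)) : 𝓜(ℂ, J)) = 0 from map_zero (DoubleCentralizer.coeHom (𝕜 := ℂ)),
      add_zero] at this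
  have hφlJ : ∀ x : 𝓜(ℂ, J), MemJ x → Continuous fun g => x * φ g := by
    rintro _ ⟨j, rfl⟩
    simpa using (hφ_cont 0 (zero_mem _) j).1
  have hφrJ : ∀ x : 𝓜(ℂ, J), MemJ x → Continuous fun g => φ g * x := by
    rintro _ ⟨j, rfl⟩
    simpa using (hφ_cont 0 (zero_mem _) j).2
  -- The sets Y k lie in J because u_k ∈ A₁ multiplies A₂ and the values of φ into J. They are
  -- compact because multiplication by u_k makes φ norm continuous.
  obtain ⟨b, X, hb, hX, hq⟩ := exists_blocks E hJ
    (F := fun k => insert (u k) (d '' Set.Iic k)) (fun k => ((Set.finite_Iic k).image d).insert _) hK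
    (Y := fun k => ((fun g => u k * φ g) '' K k ∪ (fun g => φ g * u k) '' K k) ∪
      (fun l => u k * (v l : 𝓜(ℂ, J))) '' Set.Iic k)
    (fun k => (((hK k).image (hφl _ (hu.mem k))).union ((hK k).image (hφr _ (hu.mem k)))).union
      ((Set.finite_Iic k).image _).isCompact)
    (by
      rintro k _ ((⟨g, -, rfl⟩ | ⟨g, -, rfl⟩) | ⟨l, -, rfl⟩)
      exacts [hA₁φ _ (hu.mem k) g, hφA₁ _ (hu.mem k) g, hA₁A₂ _ (hu.mem k) _ (v l).2])
    hu.nonneg hu.norm_le hu.even hε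
  have hXJ : ∀ k, MemJ (X k) := fun k => (hX k).1
  have hXr : ∀ k, ‖X k - (b (k + 1) - b k) * u k‖ ≤ ε k := fun k => (hX k).2.2.2.2
  obtain ⟨M, hM, hM0, hM1⟩ := hb.exists_strict_sum (fun k => (hX k).2.1) fun k => (hX k).2.2.1
  have hDJ : ∀ k, MemJ (b (k + 1) - b k) := fun k => MemJ.sub (hb.mem _) (hb.mem _)
  have hD1 : ∀ k, ‖b (k + 1) - b k‖ ≤ 1 := fun k =>
    (CStarAlgebra.norm_le_norm_of_nonneg_of_le (sub_nonneg.2 (hb.mono k.le_succ))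
      (sub_le_self _ (hb.nonneg k))).trans (hb.norm_le _)
  have hX1 : ∀ k, ‖X k‖ ≤ 1 := fun k =>
    (CStarAlgebra.norm_le_norm_of_nonneg_of_le (hX k).2.1 (hX k).2.2.1).trans (hD1 k)
  have hVK' : ∀ n, ∀ k ≥ n, ∀ g ∈ V n, ι g ∈ K k := fun n k hk g hg => hKmono hk (hVK n g hg)
  have hφM := StrictTendsto.memJ_and_continuous (Z := fun k g => X k * φ (ι g))
    (Y := fun g => M * φ (ι g)) (C := 2 + C)
    (fun g => by simpa only [Finset.sum_mul] using hM.mul_right (φ (ι g)))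
    (fun k g => (hXJ k).mul_right _) (fun k => (hφlJ _ (hXJ k)).comp hι) hV hVcov
    (fun k g => by
      refine (norm_mul_le _ _).trans ?_
      have := mul_le_mul (hX1 k) (hC (ι g)) (norm_nonneg _) zero_le_one
      linarith)
    (fun n k hk g hg => by
      have h1 := ((hq k).2.2 _ (Or.inl (Or.inl ⟨ι g, hVK' n k hk g hg, rfl⟩))).1
      rw [add_mul]
      exact norm_block_mul_le (hXr k) h1 (hC _))
  have hMφ := StrictTendsto.memJ_and_continuous (Z := fun k g => φ (ι g) * X k)
    (Y := fun g => φ (ι g) * M) (C := 2 + C * 3)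
    (fun g => by simpa only [Finset.mul_sum] using hM.mul_left (φ (ι g)))
    (fun k g => (hXJ k).mul_left _) (fun k => (hφrJ _ (hXJ k)).comp hι) hV hVcov
    (fun k g => by
      refine (norm_mul_le _ _).trans ?_
      have := mul_le_mul (hC (ι g)) (hX1 k) (norm_nonneg _) hC0
      linarith)
    (fun n k hk g hg => by
      have h1 := ((hq k).2.2 _ (Or.inl (Or.inr ⟨ι g, hVK' n k hk g hg, rfl⟩))).2
      have h2 := (hq k).1 (u k) (Set.mem_insert _ _)
      refine (norm_mul_block_le (hXr k) h2 h1 (hC _)).trans_eq ?_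
      change 2 * ε k + C * (ε k + 2 * ε k) = (2 + C * 3) * ε k
      ring)
  -- The 5 is 1 from moving u_k, 2 from moving D_k, and 2 from replacing X_k by D_k u_k before and
  -- after g.
  have hact := StrictTendsto.memJ_and_continuous (Z := fun k g => actHom E (ι g) (X k) - X k)
    (Y := fun g => actHom E (ι g) M - M) (C := 5)
    (fun g => by
      have h1 : StrictTendsto (fun n => actHom E (ι g) (∑ k ∈ Finset.range n, X k))
        (actHom E (ι g) M) := hM.extendAut (E.act (ι g))
      simpa only [Finset.sum_sub_distrib, map_sum] using h1.sub hM)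
    (fun k g => ((hXJ k).actHom E _).sub (hXJ k))
    (fun k => (((isGSubalgebra_ideal E).2.2 _ (hXJ k)).comp hι).sub continuous_const) hV hVcov
    (fun k g => by
      have := norm_sub_le_of_le ((norm_actHom E (ι g) _).trans_le (hX1 k)) (hX1 k)
      linarith)
    (fun n k hk g hg => by
      have h1 := (hq k).2.1 _ (hVK' n k hk g hg)
      have h2 := (huq k).2.1 _ (hVK' n k hk g hg)
      change _ ≤ 5 * ε k
      have h3 := hXr k
      have h4 := hD1 k
      generalize b (k + 1) - b k = D at h1 h3 h4
      have e1 : actHom E (ι g) (X k) - X k =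
          actHom E (ι g) D * (actHom E (ι g) (u k) - u k) + (actHom E (ι g) D - D) * u k +
            (actHom E (ι g) (X k - D * u k) - (X k - D * u k)) := by
        rw [map_sub, map_mul]
        noncomm_ring
      have a1 := (norm_mul_le (actHom E (ι g) D) (actHom E (ι g) (u k) - u k)).trans
        (mul_le_mul ((norm_actHom E (ι g) D).trans_le h4) h2 (norm_nonneg _) zero_le_one)
      have a2 := (norm_mul_le (actHom E (ι g) D - D) (u k)).trans
        (mul_le_mul h1 (hu.norm_le k) (norm_nonneg _) (by linarith [hε k]))
      have a3 := norm_sub_le_of_le ((norm_actHom E (ι g) (X k - D * u k)).trans_le h3) h3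
      rw [e1]
      refine (norm_add_le_of_le (norm_add_le_of_le a1 a2) a3).trans_eq ?_
      ring)
  have hcomm : ∀ l, MemJ (M * d l - d l * M) := by
    intro l
    refine StrictTendsto.memJ (Z := fun k => X k * d l - d l * X k) ?_
      (fun k => ((hXJ k).mul_right _).sub ((hXJ k).mul_left _)) (C := 3 + 2 * ‖d l‖) l
      fun k hk => ?_
    · simpa only [Finset.sum_sub_distrib, Finset.sum_mul, Finset.mul_sum] using
        (hM.mul_right (d l)).sub (hM.mul_left (d l))
    · have h1 := (hq k).1 (d l) (Set.mem_insert_of_mem _ ⟨l, hk, rfl⟩)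
      have h2 := (huq k).1 l hk
      have h3 := hXr k
      have h4 := hD1 k
      change _ ≤ _ * ε k
      generalize b (k + 1) - b k = D at h1 h3 h4
      have e1 : X k * d l - d l * X k = (X k - D * u k) * d l - d l * (X k - D * u k) -
          (D * (d l * u k - u k * d l) + (d l * D - D * d l) * u k) := by noncomm_ring
      have a1 := (norm_mul_le (X k - D * u k) (d l)).trans
        (mul_le_mul_of_nonneg_right h3 (norm_nonneg _))
      have a2 := (norm_mul_le (d l) (X k - D * u k)).trans
        (mul_le_mul_of_nonneg_left h3 (norm_nonneg _))
      have a3 := (norm_mul_le D (d l * u k - u k * d l)).trans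
        (mul_le_mul h4 h2 (norm_nonneg _) zero_le_one)
      have a4 := (norm_mul_le (d l * D - D * d l) (u k)).trans
        (mul_le_mul h1 (hu.norm_le k) (norm_nonneg _) (by linarith [hε k]))
      rw [e1]
      refine (norm_sub_le_of_le (norm_sub_le_of_le a1 a2) (norm_add_le_of_le a3 a4)).trans_eq ?_
      ring
  have hM2 : ∀ l, MemJ (M * (v l : 𝓜(ℂ, J))) := by
    intro l
    refine StrictTendsto.memJ (Z := fun k => X k * (v l : 𝓜(ℂ, J))) ?_
      (fun k => (hXJ k).mul_right _) (C := 2 + 1) l fun k hk => ?_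
    · simpa only [Finset.sum_mul] using hM.mul_right (v l : 𝓜(ℂ, J))
    · have h1 := ((hq k).2.2 _ (Or.inr ⟨l, hk, rfl⟩)).1
      rw [add_mul]
      exact norm_block_mul_le (hXr k) h1 (hv1 l)
  have hM1e : ∀ l, MemJ ((1 - M) * e l) := by
    intro l
    have hb1 : StrictTendsto b 1 := fun y hy => by
      rw [one_mul, mul_one]
      exact ⟨hb.tendsto_mul y hy, hb.mul_tendsto y hy⟩
    -- The increments telescope strictly to 1 - b 0. The missing term b 0 * e l is in J and is
    -- restored at the end.
    have h1 : StrictTendsto (fun n => ∑ k ∈ Finset.range n, (b (k + 1) - b k - X k) * e l)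
        ((1 - b 0 - M) * e l) := by
      have h2 := (hb1.sub (.of_tendsto (tendsto_const_nhds (x := b 0)))).sub hM
      have h3 := h2.mul_right (e l)
      refine h3.congr fun n => ?_
      rw [← Finset.sum_mul, Finset.sum_sub_distrib, Finset.sum_range_sub]
    have h2 : MemJ ((1 - b 0 - M) * e l) := by
      refine h1.memJ (fun k => ((hDJ k).sub (hXJ k)).mul_right _) (C := 2) l fun k hk => ?_
      have h3 := (huq k).2.2 l hk
      have h4 := hXr k
      have h5 := hD1 k
      change _ ≤ _ * ε k
      generalize b (k + 1) - b k = D at h4 h5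
      have e1 : (D - X k) * e l = -(D * (u k * e l - e l) + (X k - D * u k) * e l) := by
        noncomm_ring
      have a1 := (norm_mul_le D (u k * e l - e l)).trans
        (mul_le_mul h5 h3 (norm_nonneg _) zero_le_one)
      have a2 := (norm_mul_le (X k - D * u k) (e l)).trans
        (mul_le_mul h4 (he.norm_le l) (norm_nonneg _) (hε k).le)
      rw [e1, norm_neg]
      refine (norm_add_le_of_le a1 a2).trans_eq ?_
      ring
    have h3 := h2.add (MemJ.mul_right (hb.mem 0) (e l))
    have e1 : (1 - b 0 - M) * e l + b 0 * e l = (1 - M) * e l := by noncomm_ring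
    rwa [e1] at h3
  refine ⟨M, hM0, hM1, ?_, fun a ha => ?_, fun a ha => ?_, fun x hx => ?_,
    fun g => ⟨hφM.1 g, hMφ.1 g⟩, hact.1, ?_, hφM.2, hMφ.2⟩
  · have h1 : StrictTendsto (fun n => gradHom E (∑ k ∈ Finset.range n, X k)) (gradHom E M) :=
      hM.extendAut E.grading
    simp only [map_sum, fun k => (hX k).2.2.2.1] at h1
    exact h1.unique hM
  -- It suffices to know the products with the approximate unit, since a is the limit of e_l a and J
  -- is a closed ideal.
  · refine isClosed_memJ.mem_of_tendsto ((he.tendsto_mul a ha).const_mul (1 - M))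
      (Eventually.of_forall fun l => ?_)
    rw [← mul_assoc]
    exact (hM1e l).mul_right a
  · have h1 := ((continuous_subtype_val.tendsto _).comp (hv ⟨a, ha⟩).1).const_mul M
    refine isClosed_memJ.mem_of_tendsto h1 (Eventually.of_forall fun l => ?_)
    have := (hM2 l).mul_right a
    rwa [mul_assoc] at this
  · have hcl : IsClosed {x : 𝓜(ℂ, J) | MemJ (M * x - x * M)} :=
      isClosed_memJ.preimage (by fun_prop)
    refine hcl.closure_subset_iff.2 ?_ (hdΔ hx)
    rintro _ ⟨l, rfl⟩
    exact hcomm l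
  · refine (hact.2.add (continuous_const (y := M))).congr fun g => ?_
    simp

end Partition

end LoopKK

/-! ### The theorem for Sobolev loop groups -/

theorem mainTheorem5 {m m' : ℝ} (hm : 1 / 2 ≤ m) (hmm' : m < m')
    {J : Type*} [NonUnitalCStarAlgebra J]
    (E : LoopKK.GAlgebra (LoopKK.LT m) J) (hJ : LoopKK.IsSigmaUnital J)
    (A₁ A₂ : NonUnitalStarSubalgebra ℂ 𝓜(ℂ, J))
    (hA₁_closed : IsClosed (A₁ : Set 𝓜(ℂ, J))) (hA₂_closed : IsClosed (A₂ : Set 𝓜(ℂ, J)))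
    (hA₁_unital : LoopKK.IsSigmaUnital A₁) (hA₂_unital : LoopKK.IsSigmaUnital A₂)
    (hA₁_alg : LoopKK.IsGSubalgebra E A₁)
    (Δ : Set 𝓜(ℂ, J)) (hΔ : TopologicalSpace.IsSeparable Δ)
    (hΔ_derives : ∀ d ∈ Δ, ∀ b ∈ A₁, LoopKK.gradedComm E d b ∈ A₁)
    (φ : LoopKK.LT m → 𝓜(ℂ, J)) (hφ_bdd : ∃ C : ℝ, ∀ g, ‖φ g‖ ≤ C)
    (hA₁A₂ : ∀ a ∈ A₁, ∀ b ∈ A₂, LoopKK.MemJ (a * b))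
    (hA₁φ : ∀ a ∈ A₁, ∀ g, LoopKK.MemJ (a * φ g))
    (hφA₁ : ∀ a ∈ A₁, ∀ g, LoopKK.MemJ (φ g * a))
    (hφ_cont : ∀ a ∈ A₁, ∀ j : J,
      Continuous (fun g => (a + (j : 𝓜(ℂ, J))) * φ g) ∧
      Continuous (fun g => φ g * (a + (j : 𝓜(ℂ, J))))) :
    ∃ M₁ M₂ : 𝓜(ℂ, J),
      Continuous (fun g : LoopKK.LT m' => LoopKK.mAct E (LoopKK.ltIncl hmm'.le g) M₁) ∧
      Continuous (fun g : LoopKK.LT m' => LoopKK.mAct E (LoopKK.ltIncl hmm'.le g) M₂) ∧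
      LoopKK.IsPos M₁ ∧ LoopKK.IsPos M₂ ∧
      LoopKK.IsEven E M₁ ∧ LoopKK.IsEven E M₂ ∧
      M₁ + M₂ = 1 ∧
      (∀ a ∈ A₁, LoopKK.MemJ (M₁ * a)) ∧ (∀ a ∈ A₂, LoopKK.MemJ (M₂ * a)) ∧
      (∀ d ∈ Δ, LoopKK.MemJ (LoopKK.gradedComm E M₁ d) ∧
        LoopKK.MemJ (LoopKK.gradedComm E M₂ d)) ∧
      (∀ g : LoopKK.LT m', LoopKK.MemJ (M₂ * φ (LoopKK.ltIncl hmm'.le g)) ∧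
        LoopKK.MemJ (φ (LoopKK.ltIncl hmm'.le g) * M₂)) ∧
      (∀ g : LoopKK.LT m',
        LoopKK.MemJ (LoopKK.mAct E (LoopKK.ltIncl hmm'.le g) M₁ - M₁) ∧
        LoopKK.MemJ (LoopKK.mAct E (LoopKK.ltIncl hmm'.le g) M₂ - M₂)) ∧
      Continuous (fun g : LoopKK.LT m' => M₂ * φ (LoopKK.ltIncl hmm'.le g)) ∧
      Continuous (fun g : LoopKK.LT m' => φ (LoopKK.ltIncl hmm'.le g) * M₂) := by
  -- M serves as M₂ and 1 - M as M₁. Both are even, so their graded commutators are ordinary ones,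
  -- and those of M₁ are the negatives of those of M₂.
  obtain ⟨M, hM0, hM1, hMe, h1, h2, h3, h4, h5, h6, h7, h8⟩ := LoopKK.exists_partition
    (LoopKK.continuous_ltIncl hmm'.le) (K := fun n : ℕ => LoopKK.ltCompact hmm'.le n)
    (fun n => LoopKK.isCompact_ltCompact (by linarith) hmm' n)
    (fun i j hij => LoopKK.ltCompact_mono hmm'.le (by exact_mod_cast hij))
    (V := fun n : ℕ => LoopKK.ltBall m' n) (fun n => LoopKK.isOpen_ltBall m' n)
    LoopKK.exists_mem_ltBall (fun n g hg => LoopKK.ltIncl_mem_ltCompact hmm'.le hg)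
    E hJ A₁ A₂ hA₁_unital hA₂_unital hA₁_alg Δ hΔ hΔ_derives φ hφ_bdd hA₁A₂ hA₁φ hφA₁ hφ_cont
  have hMe' : LoopKK.IsEven E (1 - M) := by
    change LoopKK.gradHom E (1 - M) = 1 - M
    rw [map_sub, map_one, hMe]
  have hact : ∀ g, LoopKK.mAct E (LoopKK.ltIncl hmm'.le g) (1 - M) =
      1 - LoopKK.actHom E (LoopKK.ltIncl hmm'.le g) M := fun g => by
    rw [LoopKK.mAct_eq, map_sub, map_one]
  refine ⟨1 - M, M, ?_, h6, LoopKK.isPos_iff_nonneg.2 hM1, LoopKK.isPos_iff_nonneg.2 hM0,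
    hMe', hMe, sub_add_cancel 1 M, h1, h2, fun d hd => ⟨?_, ?_⟩, h4, fun g => ⟨?_, h5 g⟩, h7, h8⟩
  · simp only [hact]
    exact continuous_const.sub h6
  · rw [LoopKK.gradedComm_of_even E hMe']
    have e1 : (1 - M) * d - d * (1 - M) = -(M * d - d * M) := by noncomm_ring
    rw [e1]
    exact (h3 d hd).neg
  · rw [LoopKK.gradedComm_of_even E hMe]
    exact h3 d hd
  · rw [hact]
    have e1 : 1 - LoopKK.actHom E (LoopKK.ltIncl hmm'.le g) M - (1 - M) =
        -(LoopKK.actHom E (LoopKK.ltIncl hmm'.le g) M - M) := by abel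
    rw [e1]
    exact (h5 g).neg
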